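/- **Setting.** The timeline is $\mathbb{Z}$. Intervals are non-empty convex subsets of $\mathbb{Z}$; the endpoints $\varrho^-,\varrho^+$ are the greatest lower and least upper bound in $\mathbb{Z}\cup\{\pm\infty\}$ (so finite endpoints belong to $\varrho$), and the numbers mentioned by $\varrho$ are its finite endpoints. Over a function-free vocabulary, *metric atoms* are given by $M ::= \top \mid \bot \mid P(\mathbf s) \mid \Diamond^-_\varrho M \mid \Diamond^+_\varrho M \mid \Box^-_\varrho M \mid \Box^+_\varrho M \mid M\,\mathcal S_\varrho M \mid M\,\mathcal U_\varrho M$ with $\varrho$ non-negative. An interpretation $\mathfrak I$ assigns to each $t\in\mathbb Z$ a set of ground relational atoms, and $\mathfrak I,t\models M$ is the usual (strict-between) semantics: e.g. $\mathfrak I,t\models M_1\mathcal S_\varrho M_2$ iff there is $t'$ with $t-t'\in\varrho$, $\mathfrak I,t'\models M_2$ and $\mathfrak I,t''\models M_1$ for all $t'<t''<t$; $\mathfrak I,t\models \Box^-_\varrho M$ iff $\mathfrak I,t'\models M$ for all $t'$ with $t-t'\in\varrho$; the future operators are symmetric. A *rule* is $M\leftarrow M_1\wedge\dots\wedge M_k\wedge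 \mathsf{not}\,M_{k+1}\wedge\dots\wedge\mathsf{not}\,M_m$, with head built from $\top,\bot,P(\mathbf s)$ by $\Box^\pm_\varrho$. Call a variable *guarded* in a rule if it occurs in a positive body atom $M_1,\dots,M_k$ in a position other than a left operand of $\mathcal S$ or $\mathcal U$. A rule is *safe* if every variable of its head is guarded. A *program* $\Pi$ is a finite set of safe rules; $\mathsf{ground}(\Pi)$ is the set of its ground instances over all constants of the vocabulary. A *dataset* $\mathcal D$ is a finite set of relational facts $P(\mathbf c)@\varrho$. A pair $(\mathfrak H,\mathfrak T)$ with $\mathfrak H\subseteq\mathfrak T$ is an *HT-model* of $\Pi$ and $\mathcal D$ if $\mathfrak H$ is a model of $\mathcal D$ and, for every rule in $\mathsf{ground}(\Pi)$, every $t$ and each $\mathfrak X\in\{\mathfrak H,\mathfrak T\}$: if $\mathfrak X,t\models M_i$ for all $i\le k$ and $\mathfrak T,t\not\models M_j$ for all $j>k$, then $\mathfrak X,t\models M$. $\mathfrak T$ is a *stable model* if $(\mathfrak T,\mathfrak T)$ is an HT-model and $\mathfrak T$ is the least $\mathfrak H$ such that $(\mathfrak H,\mathfrak T)$ is an HT-model.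 $\Pi$ is *normalised* if heads are relational atoms or $\bot$, and bodies contain no diamonds, no nested metric operators, and no unbounded interval other than $[0,\infty)$. Let $\mathsf{ground}(\Pi,\mathcal D)$ be the set of rules of $\mathsf{ground}(\Pi)$ mentioning only constants of $\Pi$ and $\mathcal D$. Let $\mathsf{at}(\Pi,\mathcal D)$ consist of all relational atoms of $\mathcal D$, all metric atoms occurring (possibly nested) in $\mathsf{ground}(\Pi,\mathcal D)$, and all $\Box^-_{[0,\infty)}M$, $\Box^+_{[0,\infty)}M$ with $M$ a relational atom mentioned in $\mathsf{ground}(\Pi,\mathcal D)$. Let $t_\Pi$ be the largest positive number mentioned in $\Pi$ ($1$ if none), $t^{\min}_{\mathcal D},t^{\max}_{\mathcal D}$ the smallest and largest numbers mentioned in $\mathcal D$ (both $0$ if none), and $\varrho_{\Pi,\mathcal D}=[t^{\min}_{\mathcal D},t^{\max}_{\mathcal D}+t_\Pi]$. A *window* is a tuple $(\varrho,H,T,b)$ with $\varrho$ a bounded interval, $b\in\{0,1\}$, and $H\subseteq T$ sets of facts $M@t$ with $M\in\mathsf{at}(\Pi,\mathcal D)$, $t\in\varrho$, such that for some interpretations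 $\mathfrak H,\mathfrak T$ and all such $M,t$: $M@t\in H$ iff $\mathfrak H,t\models M$, and $M@t\in T$ iff $\mathfrak T,t\models M$. It is *initial* if $H=T$ and $b=0$, or $H\ne T$ and $b=1$. It *locally satisfies* $\Pi$ if for every rule in $\mathsf{ground}(\Pi)$, $t\in\varrho$ and $X\in\{H,T\}$: if $M_i@t\in X$ for all $i\le k$ and $M_j@t\notin T$ for all $j>k$, then $M@t\in X$. For a set $F$ of facts, $F\models\mathcal D$ means that every model of $F$ is a model of $\mathcal D$. For an initial window $\mathcal W_0$ locally satisfying $\Pi$, $\mathcal A^{\leftarrow}_{\mathcal W_0}$ is the generalised nondeterministic Büchi automaton whose states are the windows of the same length as $\mathcal W_0$ locally satisfying $\Pi$; whose letters are the subsets $\sigma$ of $\mathsf{at}(\Pi,\mathcal D)$; whose initial state is $\mathcal W_0$; which can move from $(\varrho,H,T,b)$ to $(\varrho',H',T',b')$ on $\sigma$ iff $\varrho'=[\varrho^--1,\varrho^+-1]$, $H$ and $H'$ agree on $\varrho\cap\varrho'$, $T'=\{M@t\in T: t\in\varrho'\}\cup\{M@(\varrho^--1):M\in\sigma\}$, and $b'=1$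 exactly if $b=1$ or $H'\neq T'$; and whose accepting condition contains, for each $X\in\{H,T\}$, the set of states such that some $t\in\varrho$ has $\Box^-_{[0,\infty)}M@t\in X$ or $M@t\notin X$, for every $\Box^-_{[0,\infty)}M\in\mathsf{at}(\Pi,\mathcal D)$, and the set of states such that some $t\in\varrho$ has $M_1\mathcal S_{[0,\infty)}M_2@t\notin X$ or $M_2@t\in X$, for every $M_1\mathcal S_{[0,\infty)}M_2\in\mathsf{at}(\Pi,\mathcal D)$. A word is accepted if some run on it visits each set of the accepting condition infinitely often. $\mathcal A^{\rightarrow}_{\mathcal W_0}$ is defined symmetrically, moving by $+1$, adding the facts of $\sigma$ at $\varrho^++1$, and using $\Box^+,\mathcal U$ for $\Box^-,\mathcal S$. If $H_0=T_0$ and $b_0=0$, $\mathcal B^{\leftrightarrows}_{\mathcal W_0}$ is $\mathcal A^{\leftrightarrows}_{\mathcal W_0}$ with states restricted to those with $H=T$; $\mathcal C^{\leftrightarrows}_{\mathcal W_0}$ is $\mathcal A^{\leftrightarrows}_{\mathcal W_0}$ with the set of states with $b=1$ added to the accepting condition. **Theorem.** Let $\Pi$ be a normalised program and $\mathcal D$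 a dataset. Assume that (i) the atom of every fact of $\mathcal D$ with an unbounded interval is mentioned in $\mathsf{ground}(\Pi,\mathcal D)$; and (ii) if the vocabulary has a constant mentioned neither in $\Pi$ nor in $\mathcal D$, then whenever a rule of $\Pi$ contains an unguarded variable, $\Pi$ and $\mathcal D$ mention at least one constant, and that variable does not occur in this rule both in a left operand of $\mathcal S$ or $\mathcal U$ and in a negated body atom. Then $\Pi$ and $\mathcal D$ have a stable model if and only if there exists an initial window $\mathcal W_0=(\varrho_{\Pi,\mathcal D},T_0,T_0,0)$ locally satisfying $\Pi$ with $T_0\models\mathcal D$, and there exist infinite words $\overleftarrow w$, $\overrightarrow w$ over $2^{\mathsf{at}(\Pi,\mathcal D)}$ such that 1. $\overleftarrow w$ and $\overrightarrow w$ are accepted by $\mathcal B^{\leftarrow}_{\mathcal W_0}$ and $\mathcal B^{\rightarrow}_{\mathcal W_0}$, respectively; and 2. there is no initial window $\mathcal W_0'=(\varrho_{\Pi,\mathcal D},H_0,T_0,b_0)$ locally satisfying $\Pi$ such that $H_0\models\mathcal D$ and $\overleftarrow w,\overrightarrow w$ are accepted either by $\mathcal C^{\leftarrow}_{\mathcal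 W_0'}$ and $\mathcal A^{\rightarrow}_{\mathcal W_0'}$, respectively, or by $\mathcal A^{\leftarrow}_{\mathcal W_0'}$ and $\mathcal C^{\rightarrow}_{\mathcal W_0'}$, respectively. -/

import Mathlib

open Filter

universe u v w

set_option linter.checkUnivs false in
/-- A function-free first-order vocabulary, together with a supply of variables. -/
structure Vocabulary where
  Pred : Type u
  arity : Pred → ℕ
  Const : Type v
  Var : Type w

namespace DatalogMTL

/-! ### Intervals of the integer timeline -/

/-- A non-empty interval of the integer timeline. Its endpoints are its greatest lower bound and
its least upper bound; when finite they belong to it. -/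
structure Interval where
  carrier : Set ℤ
  nonempty : carrier.Nonempty
  ordConnected : carrier.OrdConnected

/-- Both endpoints are integers. -/
def Interval.Bounded (ρ : Interval) : Prop := BddBelow ρ.carrier ∧ BddAbove ρ.carrier

/-- The numbers mentioned by an interval: its finite endpoints. -/
def Interval.numbers (ρ : Interval) : Set ℤ :=
  {n | IsLeast ρ.carrier n ∨ IsGreatest ρ.carrier n}

/-- Non-empty intervals without negative elements: the subscripts of the metric operators. -/
structure NNInterval extends Interval where
  nonneg : ∀ t ∈ carrier, 0 ≤ t

/-- The interval `[0, ∞)`. -/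
def NNInterval.unb : NNInterval where
  carrier := Set.Ici 0
  nonempty := Set.nonempty_Ici
  ordConnected := Set.ordConnected_Ici
  nonneg := fun _ h => h

/-! ### Metric atoms -/

/-- Relational atoms `P(s)` whose arguments are taken from `τ`. -/
structure RelAtom (V : Vocabulary.{u, v, w}) (τ : Type*) where
  pred : V.Pred
  args : Fin (V.arity pred) → τ

/-- Metric atoms. The terms are `V.Const ⊕ V.Var` in general and `V.Const` for ground atoms. -/
inductive MAtom (V : Vocabulary.{u, v, w}) (τ : Type*) where
  | top : MAtom V τ
  | bot : MAtom V τ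
  | rel (A : RelAtom V τ) : MAtom V τ
  | diaMinus (ρ : NNInterval) (M : MAtom V τ) : MAtom V τ
  | diaPlus (ρ : NNInterval) (M : MAtom V τ) : MAtom V τ
  | boxMinus (ρ : NNInterval) (M : MAtom V τ) : MAtom V τ
  | boxPlus (ρ : NNInterval) (M : MAtom V τ) : MAtom V τ
  | since (ρ : NNInterval) (M₁ M₂ : MAtom V τ) : MAtom V τ
  | untl (ρ : NNInterval) (M₁ M₂ : MAtom V τ) : MAtom V τ

section Atoms

variable {V : Vocabulary.{u, v, w}} {τ τ' : Type*}

/-- Replace every term by its image. -/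
def RelAtom.map (f : τ → τ') (A : RelAtom V τ) : RelAtom V τ' := ⟨A.pred, fun i => f (A.args i)⟩

namespace MAtom

/-- Replace every term by its image. -/
def map (f : τ → τ') : MAtom V τ → MAtom V τ'
  | top => top
  | bot => bot
  | rel A => rel (A.map f)
  | diaMinus ρ M => diaMinus ρ (M.map f)
  | diaPlus ρ M => diaPlus ρ (M.map f)
  | boxMinus ρ M => boxMinus ρ (M.map f)
  | boxPlus ρ M => boxPlus ρ (M.map f)
  | since ρ M₁ M₂ => since ρ (M₁.map f) (M₂.map f)
  | untl ρ M₁ M₂ => untl ρ (M₁.map f) (M₂.map f)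

/-- The metric atoms occurring in a metric atom, itself included. -/
def subatoms : MAtom V τ → Set (MAtom V τ)
  | top => {top}
  | bot => {bot}
  | rel A => {rel A}
  | diaMinus ρ M => {diaMinus ρ M} ∪ M.subatoms
  | diaPlus ρ M => {diaPlus ρ M} ∪ M.subatoms
  | boxMinus ρ M => {boxMinus ρ M} ∪ M.subatoms
  | boxPlus ρ M => {boxPlus ρ M} ∪ M.subatoms
  | since ρ M₁ M₂ => {since ρ M₁ M₂} ∪ (M₁.subatoms ∪ M₂.subatoms)
  | untl ρ M₁ M₂ => {untl ρ M₁ M₂} ∪ (M₁.subatoms ∪ M₂.subatoms)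

/-- The terms occurring in a metric atom. -/
def terms : MAtom V τ → Set τ
  | top => ∅
  | bot => ∅
  | rel A => Set.range A.args
  | diaMinus _ M => M.terms
  | diaPlus _ M => M.terms
  | boxMinus _ M => M.terms
  | boxPlus _ M => M.terms
  | since _ M₁ M₂ => M₁.terms ∪ M₂.terms
  | untl _ M₁ M₂ => M₁.terms ∪ M₂.terms

/-- The terms with an occurrence outside all left operands of `since` and `untl`. -/
def nonLeftTerms : MAtom V τ → Set τ
  | top => ∅
  | bot => ∅
  | rel A => Set.range A.args
  | diaMinus _ M => M.nonLeftTerms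
  | diaPlus _ M => M.nonLeftTerms
  | boxMinus _ M => M.nonLeftTerms
  | boxPlus _ M => M.nonLeftTerms
  | since _ _ M₂ => M₂.nonLeftTerms
  | untl _ _ M₂ => M₂.nonLeftTerms

/-- The terms with an occurrence inside a left operand of `since` or `untl`. -/
def leftTerms : MAtom V τ → Set τ
  | top => ∅
  | bot => ∅
  | rel _ => ∅
  | diaMinus _ M => M.leftTerms
  | diaPlus _ M => M.leftTerms
  | boxMinus _ M => M.leftTerms
  | boxPlus _ M => M.leftTerms
  | since _ M₁ M₂ => M₁.terms ∪ M₂.leftTerms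
  | untl _ M₁ M₂ => M₁.terms ∪ M₂.leftTerms

/-- The numbers mentioned in a metric atom. -/
def numbers : MAtom V τ → Set ℤ
  | top => ∅
  | bot => ∅
  | rel _ => ∅
  | diaMinus ρ M => ρ.numbers ∪ M.numbers
  | diaPlus ρ M => ρ.numbers ∪ M.numbers
  | boxMinus ρ M => ρ.numbers ∪ M.numbers
  | boxPlus ρ M => ρ.numbers ∪ M.numbers
  | since ρ M₁ M₂ => ρ.numbers ∪ (M₁.numbers ∪ M₂.numbers)
  | untl ρ M₁ M₂ => ρ.numbers ∪ (M₁.numbers ∪ M₂.numbers)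

/-- The grammar of rule heads. -/
def IsHead : MAtom V τ → Prop
  | top => True
  | bot => True
  | rel _ => True
  | boxMinus _ M => M.IsHead
  | boxPlus _ M => M.IsHead
  | _ => False

theorem IsHead.map (f : τ → τ') : ∀ {M : MAtom V τ}, M.IsHead → (M.map f).IsHead
  | top, _ => trivial
  | bot, _ => trivial
  | rel _, _ => trivial
  | boxMinus _ M, h => IsHead.map f (M := M) h
  | boxPlus _ M, h => IsHead.map f (M := M) h

/-- Atoms without metric operators. -/
def IsPlain : MAtom V τ → Prop
  | top => True
  | bot => True
  | rel _ => True
  | _ => False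

/-- Atoms allowed in the bodies of normalised rules: no diamonds, no nesting of metric operators,
and `[0, ∞)` as the only unbounded interval. -/
def IsNormal : MAtom V τ → Prop
  | top => True
  | bot => True
  | rel _ => True
  | diaMinus _ _ => False
  | diaPlus _ _ => False
  | boxMinus ρ M => (ρ.Bounded ∨ ρ = NNInterval.unb) ∧ M.IsPlain
  | boxPlus ρ M => (ρ.Bounded ∨ ρ = NNInterval.unb) ∧ M.IsPlain
  | since ρ M₁ M₂ => (ρ.Bounded ∨ ρ = NNInterval.unb) ∧ M₁.IsPlain ∧ M₂.IsPlain
  | untl ρ M₁ M₂ => (ρ.Bounded ∨ ρ = NNInterval.unb) ∧ M₁.IsPlain ∧ M₂.IsPlain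

end MAtom

end Atoms

/-! ### Rules, programs and datasets -/

/-- A rule `head ← pos₁ ∧ … ∧ posₖ ∧ not neg₁ ∧ … ∧ not negₗ`. -/
structure Rule (V : Vocabulary.{u, v, w}) (τ : Type*) where
  head : MAtom V τ
  pos : List (MAtom V τ)
  neg : List (MAtom V τ)
  isHead : head.IsHead

section Rules

variable {V : Vocabulary.{u, v, w}} {τ τ' : Type*}

namespace Rule

/-- Replace every term by its image. -/
def map (f : τ → τ') (r : Rule V τ) : Rule V τ' :=
  ⟨r.head.map f, r.pos.map (MAtom.map f), r.neg.map (MAtom.map f), r.isHead.map f⟩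

/-- `M` is the head or a (positive or negated) body atom of `r`. -/
def Has (r : Rule V τ) (M : MAtom V τ) : Prop := M = r.head ∨ M ∈ r.pos ∨ M ∈ r.neg

/-- All metric atoms occurring in a rule, also below metric operators. -/
def subatoms (r : Rule V τ) : Set (MAtom V τ) := {N | ∃ M, r.Has M ∧ N ∈ M.subatoms}

/-- The terms occurring in a rule. -/
def terms (r : Rule V τ) : Set τ := {s | ∃ M, r.Has M ∧ s ∈ M.terms}

/-- The numbers mentioned in a rule. -/
def numbers (r : Rule V τ) : Set ℤ := {n | ∃ M, r.Has M ∧ n ∈ M.numbers}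

/-- The variable `x` occurs in some positive body atom in a position other than a left operand
of `since` or `untl`. -/
def Guarded (r : Rule V (V.Const ⊕ V.Var)) (x : V.Var) : Prop :=
  ∃ M ∈ r.pos, Sum.inr x ∈ M.nonLeftTerms

/-- Every variable of the head is guarded. -/
def Safe (r : Rule V (V.Const ⊕ V.Var)) : Prop := ∀ x, Sum.inr x ∈ r.head.terms → r.Guarded x

/-- Normalised rules. -/
def IsNormal (r : Rule V τ) : Prop :=
  ((∃ A, r.head = MAtom.rel A) ∨ r.head = MAtom.bot) ∧
    (∀ M ∈ r.pos, M.IsNormal) ∧ (∀ M ∈ r.neg, M.IsNormal)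

end Rule

end Rules

/-- A program: a finite set of safe rules. -/
structure Program (V : Vocabulary.{u, v, w}) where
  rules : Finset (Rule V (V.Const ⊕ V.Var))
  safe : ∀ r ∈ rules, r.Safe

/-- A relational fact `P(c)@ρ`. -/
structure RelFact (V : Vocabulary.{u, v, w}) where
  atom : RelAtom V V.Const
  interval : Interval

/-- A dataset: a finite set of relational facts. -/
abbrev Dataset (V : Vocabulary.{u, v, w}) := Finset (RelFact V)

section Semantics

variable {V : Vocabulary.{u, v, w}}

def Program.Normalised (Pr : Program V) : Prop := ∀ r ∈ Pr.rules, r.IsNormal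

/-- Ground rules obtained from `Pr` by replacing variables with constants: `θ` acts on variables
only, and its result mentions no variable. -/
def Program.ground (Pr : Program V) : Set (Rule V V.Const) :=
  {g | ∃ r ∈ Pr.rules, ∃ θ : V.Var → V.Const ⊕ V.Var,
    r.map (Sum.elim Sum.inl θ) = g.map Sum.inl}

/-- The constants mentioned in the program or in the dataset. -/
def constants (Pr : Program V) (D : Dataset V) : Set V.Const :=
  {c | (∃ r ∈ Pr.rules, Sum.inl c ∈ r.terms) ∨ (∃ f ∈ D, c ∈ Set.range f.atom.args)}

/-- The ground rules that mention only constants from the program and the dataset. -/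
def groundOn (Pr : Program V) (D : Dataset V) : Set (Rule V V.Const) :=
  {g | g ∈ Pr.ground ∧ g.terms ⊆ constants Pr D}

/-- Interpretations over the integer timeline, ordered by pointwise inclusion. -/
abbrev Interp (V : Vocabulary.{u, v, w}) := ℤ → Set (RelAtom V V.Const)

/-- `Sat I t M`: the ground metric atom `M` is satisfied at `t` in `I`. -/
def Sat (I : Interp V) : ℤ → MAtom V V.Const → Prop
  | _, .top => True
  | _, .bot => False
  | t, .rel A => A ∈ I t
  | t, .diaMinus ρ M => ∃ t', t - t' ∈ ρ.carrier ∧ Sat I t' M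
  | t, .diaPlus ρ M => ∃ t', t' - t ∈ ρ.carrier ∧ Sat I t' M
  | t, .boxMinus ρ M => ∀ t', t - t' ∈ ρ.carrier → Sat I t' M
  | t, .boxPlus ρ M => ∀ t', t' - t ∈ ρ.carrier → Sat I t' M
  | t, .since ρ M₁ M₂ =>
      ∃ t', t - t' ∈ ρ.carrier ∧ Sat I t' M₂ ∧ ∀ s, t' < s → s < t → Sat I s M₁
  | t, .untl ρ M₁ M₂ =>
      ∃ t', t' - t ∈ ρ.carrier ∧ Sat I t' M₂ ∧ ∀ s, t < s → s < t' → Sat I s M₁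

/-- `I` is a model of the dataset `D`. -/
def ModelsData (I : Interp V) (D : Dataset V) : Prop :=
  ∀ f ∈ D, ∀ t ∈ f.interval.carrier, f.atom ∈ I t

/-- `(H, T)` is an HT-interpretation that is an HT-model of the program and of the dataset. -/
def IsHTModel (Pr : Program V) (D : Dataset V) (H T : Interp V) : Prop :=
  H ≤ T ∧ ModelsData H D ∧
    ∀ g ∈ Pr.ground, ∀ t : ℤ,
      ((∀ M ∈ g.pos, Sat H t M) → (∀ M ∈ g.neg, ¬ Sat T t M) → Sat H t g.head) ∧
      ((∀ M ∈ g.pos, Sat T t M) → (∀ M ∈ g.neg, ¬ Sat T t M) → Sat T t g.head)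

/-- `T` is a stable model: `(T, T)` is an HT-model, and `T` is the least among the interpretations
`H` such that `(H, T)` is an HT-model. -/
def IsStableModel (Pr : Program V) (D : Dataset V) (T : Interp V) : Prop :=
  IsHTModel Pr D T T ∧ IsLeast {H | IsHTModel Pr D H T} T

/-! ### The closure `at(Π, D)` and the distinguished numbers -/

/-- The relational atom `A` is mentioned in the grounding over the constants of `Pr` and `D`. -/
def Mentioned (Pr : Program V) (D : Dataset V) (A : RelAtom V V.Const) : Prop :=
  ∃ g ∈ groundOn Pr D, MAtom.rel A ∈ g.subatoms

/-- The finite set `at(Π, D)` of relevant ground metric atoms. -/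
def atoms (Pr : Program V) (D : Dataset V) : Set (MAtom V V.Const) :=
  {M | (∃ f ∈ D, M = MAtom.rel f.atom) ∨
    (∃ g ∈ groundOn Pr D, M ∈ g.subatoms) ∨
    (∃ A, Mentioned Pr D A ∧
      (M = MAtom.boxMinus NNInterval.unb (MAtom.rel A) ∨
       M = MAtom.boxPlus NNInterval.unb (MAtom.rel A)))}

/-- The numbers mentioned in a dataset. -/
def dataNumbers (D : Dataset V) : Set ℤ := {n | ∃ f ∈ D, n ∈ f.interval.numbers}

open Classical in
/-- The smallest number mentioned in `D`, or `0` if there is none. -/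
noncomputable def tMin (D : Dataset V) : ℤ :=
  if (dataNumbers D).Nonempty then sInf (dataNumbers D) else 0

open Classical in
/-- The largest number mentioned in `D`, or `0` if there is none. -/
noncomputable def tMax (D : Dataset V) : ℤ :=
  if (dataNumbers D).Nonempty then sSup (dataNumbers D) else 0

/-- The positive numbers mentioned in a program. -/
def posNumbers (Pr : Program V) : Set ℤ := {n | 0 < n ∧ ∃ r ∈ Pr.rules, n ∈ r.numbers}

open Classical in
/-- The largest positive number mentioned in a program, or `1` if there is none. -/
noncomputable def tProg (Pr : Program V) : ℤ :=
  if (posNumbers Pr).Nonempty then sSup (posNumbers Pr) else 1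

/-! ### Windows -/

/-- A punctual metric fact `M@t`, as the pair `(M, t)`. -/
abbrev TimedAtom (V : Vocabulary.{u, v, w}) := MAtom V V.Const × ℤ

/-- Every model of the set `F` of metric facts is a model of `D`. -/
def FactsEntail (F : Set (TimedAtom V)) (D : Dataset V) : Prop :=
  ∀ I : Interp V, (∀ p ∈ F, Sat I p.2 p.1) → ModelsData I D

/-- Tuples `([lo, hi], H, T, b)`. -/
@[ext] structure WTuple (V : Vocabulary.{u, v, w}) where
  lo : ℤ
  hi : ℤ
  H : Set (TimedAtom V)
  T : Set (TimedAtom V)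
  b : Bool

namespace WTuple

/-- Some interpretation agrees with `F` on all atoms of `at(Π, D)` and all points of `[lo, hi]`. -/
def Realised (Pr : Program V) (D : Dataset V) (lo hi : ℤ) (F : Set (TimedAtom V)) : Prop :=
  ∃ I : Interp V, ∀ M ∈ atoms Pr D, ∀ t ∈ Set.Icc lo hi, ((M, t) ∈ F ↔ Sat I t M)

/-- The tuple is a window. -/
def IsWindow (Pr : Program V) (D : Dataset V) (W : WTuple V) : Prop :=
  W.lo ≤ W.hi ∧ (∀ p ∈ W.T, p.1 ∈ atoms Pr D ∧ p.2 ∈ Set.Icc W.lo W.hi) ∧ W.H ⊆ W.T ∧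
    Realised Pr D W.lo W.hi W.H ∧ Realised Pr D W.lo W.hi W.T

/-- The window is initial. -/
def Initial (W : WTuple V) : Prop := (W.H = W.T ∧ W.b = false) ∨ (W.H ≠ W.T ∧ W.b = true)

/-- The window locally satisfies the program. -/
def LocallySatisfies (Pr : Program V) (W : WTuple V) : Prop :=
  ∀ g ∈ Pr.ground, ∀ t ∈ Set.Icc W.lo W.hi,
    ((∀ M ∈ g.pos, (M, t) ∈ W.H) → (∀ M ∈ g.neg, (M, t) ∉ W.T) → (g.head, t) ∈ W.H) ∧
    ((∀ M ∈ g.pos, (M, t) ∈ W.T) → (∀ M ∈ g.neg, (M, t) ∉ W.T) → (g.head, t) ∈ W.T)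

/-- An initial window that locally satisfies the program. -/
def IsStart (Pr : Program V) (D : Dataset V) (W : WTuple V) : Prop :=
  W.IsWindow Pr D ∧ W.Initial ∧ W.LocallySatisfies Pr

end WTuple

/-! ### Generalised Büchi automata -/

/-- Generalised nondeterministic Büchi automata with states in `Q` and letters in `A`. -/
structure GBA (Q A : Type*) where
  states : Set Q
  alphabet : Set A
  δ : Q → A → Set Q
  init : Q
  acc : Set (Set Q)

/-- The automaton has an accepting run on the infinite word `x`: a run that visits each set of the
accepting condition infinitely often. -/
def GBA.Accepts {Q A : Type*} (𝒜 : GBA Q A) (x : ℕ → A) : Prop :=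
  (∀ n, x n ∈ 𝒜.alphabet) ∧
    ∃ run : ℕ → Q, run 0 = 𝒜.init ∧ (∀ n, run n ∈ 𝒜.states) ∧
      (∀ n, run (n + 1) ∈ 𝒜.δ (run n) (x n)) ∧
      ∀ S ∈ 𝒜.acc, ∃ᶠ n in atTop, run n ∈ S

/-- The directions in which the automata move. -/
inductive Dir where
  | left
  | right

/-- Displacement of the window in one step. -/
def Dir.step : Dir → ℤ
  | .left => -1
  | .right => 1

/-- The time point by which the window is extended in one step. -/
def Dir.newPoint (d : Dir) (W : WTuple V) : ℤ :=
  match d with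
  | .left => W.lo - 1
  | .right => W.hi + 1

/-- The box operator with interval `[0, ∞)` for the given direction. -/
def Dir.box (d : Dir) (M : MAtom V V.Const) : MAtom V V.Const :=
  match d with
  | .left => .boxMinus NNInterval.unb M
  | .right => .boxPlus NNInterval.unb M

/-- The operator `since` (left) or `untl` (right) with interval `[0, ∞)`. -/
def Dir.reach (d : Dir) (M₁ M₂ : MAtom V V.Const) : MAtom V V.Const :=
  match d with
  | .left => .since NNInterval.unb M₁ M₂
  | .right => .untl NNInterval.unb M₁ M₂

/-- The states of the automata for the initial window `W₀`: the windows of the same length that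
locally satisfy the program. -/
def autStates (Pr : Program V) (D : Dataset V) (W₀ : WTuple V) : Set (WTuple V) :=
  {W | W.IsWindow Pr D ∧ W.LocallySatisfies Pr ∧ W.hi - W.lo = W₀.hi - W₀.lo}

/-- The transition relation. -/
def autTrans (Pr : Program V) (D : Dataset V) (d : Dir) (W : WTuple V)
    (σ : Set (MAtom V V.Const)) : Set (WTuple V) :=
  {W' | W'.lo = W.lo + d.step ∧ W'.hi = W.hi + d.step ∧
    (∀ M ∈ atoms Pr D, ∀ t ∈ Set.Icc W'.lo W'.hi ∩ Set.Icc W.lo W.hi,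
      ((M, t) ∈ W'.H ↔ (M, t) ∈ W.H)) ∧
    W'.T = {p | p ∈ W.T ∧ p.2 ∈ Set.Icc W'.lo W'.hi} ∪ {p | p.1 ∈ σ ∧ p.2 = d.newPoint W} ∧
    (W'.b = true ↔ W.b = true ∨ W'.H ≠ W'.T)}

/-- The accepting condition. -/
def autAcc (Pr : Program V) (D : Dataset V) (d : Dir) (W₀ : WTuple V) : Set (Set (WTuple V)) :=
  {S | (∃ M, d.box M ∈ atoms Pr D ∧
      (S = {W | W ∈ autStates Pr D W₀ ∧
          ∃ t ∈ Set.Icc W.lo W.hi, (d.box M, t) ∈ W.H ∨ (M, t) ∉ W.H} ∨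
       S = {W | W ∈ autStates Pr D W₀ ∧
          ∃ t ∈ Set.Icc W.lo W.hi, (d.box M, t) ∈ W.T ∨ (M, t) ∉ W.T})) ∨
    (∃ M₁ M₂, d.reach M₁ M₂ ∈ atoms Pr D ∧
      (S = {W | W ∈ autStates Pr D W₀ ∧
          ∃ t ∈ Set.Icc W.lo W.hi, (d.reach M₁ M₂, t) ∉ W.H ∨ (M₂, t) ∈ W.H} ∨
       S = {W | W ∈ autStates Pr D W₀ ∧
          ∃ t ∈ Set.Icc W.lo W.hi, (d.reach M₁ M₂, t) ∉ W.T ∨ (M₂, t) ∈ W.T}))}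

/-- The automaton `𝒜` for `W₀` in direction `d`. -/
def autA (Pr : Program V) (D : Dataset V) (d : Dir) (W₀ : WTuple V) :
    GBA (WTuple V) (Set (MAtom V V.Const)) where
  states := autStates Pr D W₀
  alphabet := {σ | σ ⊆ atoms Pr D}
  δ := autTrans Pr D d
  init := W₀
  acc := autAcc Pr D d W₀

/-- The automaton `ℬ`: states are required to satisfy `H = T`. -/
def autB (Pr : Program V) (D : Dataset V) (d : Dir) (W₀ : WTuple V) :
    GBA (WTuple V) (Set (MAtom V V.Const)) :=
  { autA Pr D d W₀ with states := {W | W ∈ autStates Pr D W₀ ∧ W.H = W.T} }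

/-- The automaton `𝒞`: the accepting condition has the additional set of states with flag `1`. -/
def autC (Pr : Program V) (D : Dataset V) (d : Dir) (W₀ : WTuple V) :
    GBA (WTuple V) (Set (MAtom V V.Const)) :=
  { autA Pr D d W₀ with
    acc := autAcc Pr D d W₀ ∪ {{W | W ∈ autStates Pr D W₀ ∧ W.b = true}} }

/-- The tuple `(ϱ, H, T, b)` over the interval `ϱ = [tMin, tMax + tProg]` determined by the
program and the dataset. -/
noncomputable def baseWindow (Pr : Program V) (D : Dataset V) (H T : Set (TimedAtom V))
    (b : Bool) : WTuple V :=
  ⟨tMin D, tMax D + tProg Pr, H, T, b⟩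

end Semantics

end DatalogMTL

/-!
The idea is that a pair of runs to the left and to the right from a common window is the same thing
as an HT-model, cut into overlapping windows, and that the words only record its second component.

*From runs to models.* Consecutive windows agree on their overlap, so the windows of a two-sided
run (`IsBiRun`) glue to sets of facts over the whole timeline (`isTrack_iUnion`). Each window is
realised by some interpretation, and windows are at least as long as the largest number of the
program. Hence the truth values recorded for bounded operators are determined by those of their
operands, and those of the operators with interval `[0, ∞)` obey the usual one-step recurrence. A
recurrence alone admits a second solution, in which a box is never violated and yet false, or a
`since` or `until` is postponed forever; the accepting condition rules it out
(`since_iff_of_recurrence`, `box_iff_of_recurrence`). So the glued sets contain exactly the facts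
over the closure that hold in the interpretation given by their relational facts
(`IsTrack.sat_iff`), and local satisfaction of the program in all windows yields an HT-model
(`IsBiRun.exists_isHTModel`). Its second component is determined by the initial window and the
words (`IsBiRun.T_eq`).

*From models to runs.* Conversely the windows of an HT-model form a two-sided run
(`isBiRun_windowsOf`). Its initial window entails the data, because the closure contains the boxes
over atoms of unbounded facts (`factsEntail_facts`).

*Grounding.* Windows only record atoms over the constants of the program and the dataset, whereas
rules are grounded over all constants. For interpretations within the closure, satisfaction of all
ground rules is the same as satisfaction with atoms outside the closure counted as false
(`SatWithin.sat_head`, `satWithin_of_forall`). An unknown constant is assigned to unguarded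
variables only. In a left operand of the positive body, it can be replaced by a known constant,
since atoms with unknown constants never hold; if it occurs outside left operands of a negated
atom, that atom does not hold. The proviso excludes that a variable needs both treatments. Stable
models are within the closure by minimality (`IsStableModel.within`).

*Stability.* The interpretation `T` described by accepted words is stable iff there is no
HT-model `(H, T)` with `H ≠ T`, that is, no two-sided run on the same words in which the flag is
raised somewhere on the left or on the right. A raised flag stays raised, so this is what the
automata `𝒞` detect (`IsStableModel.exists_words`, `exists_isStableModel`).
-/

namespace DatalogMTL

/-! ### Substitutions, subatoms and terms -/

section SyntacticLemmas

variable {V : Vocabulary.{u, v, w}} {τ τ' τ'' : Type*}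

namespace MAtom

theorem map_map (f : τ → τ') (g : τ' → τ'') (M : MAtom V τ) :
    (M.map f).map g = M.map (g ∘ f) := by
  induction M <;> simp_all [map, RelAtom.map]

theorem map_congr {f g : τ → τ'} {M : MAtom V τ} (h : ∀ s ∈ M.terms, f s = g s) :
    M.map f = M.map g := by
  induction M <;> simp_all [map, RelAtom.map, terms]

theorem map_id (M : MAtom V τ) : M.map id = M := by
  induction M <;> simp_all [map, RelAtom.map]

theorem terms_map (f : τ → τ') (M : MAtom V τ) : (M.map f).terms = f '' M.terms := by
  induction M <;> simp_all [map, RelAtom.map, terms, Set.image_union, ← Set.range_comp,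
    Function.comp_def]

theorem nonLeftTerms_map (f : τ → τ') (M : MAtom V τ) :
    (M.map f).nonLeftTerms = f '' M.nonLeftTerms := by
  induction M <;> simp_all [map, RelAtom.map, nonLeftTerms, ← Set.range_comp,
    Function.comp_def]

theorem numbers_map (f : τ → τ') (M : MAtom V τ) : (M.map f).numbers = M.numbers := by
  induction M <;> simp_all [map, numbers]

theorem isPlain_map (f : τ → τ') (M : MAtom V τ) : (M.map f).IsPlain ↔ M.IsPlain := by
  cases M <;> simp [map, IsPlain]

theorem isNormal_map (f : τ → τ') (M : MAtom V τ) : (M.map f).IsNormal ↔ M.IsNormal := by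
  cases M <;> simp [map, IsNormal, isPlain_map]

theorem mem_left_or_nonLeft {M : MAtom V τ} {s : τ} (h : s ∈ M.terms) :
    s ∈ M.leftTerms ∨ s ∈ M.nonLeftTerms := by
  induction M <;> simp_all [terms, leftTerms, nonLeftTerms]
  all_goals tauto

theorem nonLeftTerms_subset_terms (M : MAtom V τ) : M.nonLeftTerms ⊆ M.terms := by
  induction M <;> simp_all [terms, nonLeftTerms]
  all_goals exact Set.subset_union_of_subset_right ‹_› _

theorem mem_subatoms_self (M : MAtom V τ) : M ∈ M.subatoms := by
  cases M <;> simp [subatoms]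

theorem subatoms_subset {M N : MAtom V τ} (h : N ∈ M.subatoms) : N.subatoms ⊆ M.subatoms := by
  induction M with
  | top | bot | rel => simp only [subatoms, Set.mem_singleton_iff] at h; subst h; rfl
  | diaMinus ρ M ih | diaPlus ρ M ih | boxMinus ρ M ih | boxPlus ρ M ih =>
    rcases h with h | h
    · rw [Set.mem_singleton_iff] at h; subst h; rfl
    · exact (ih h).trans Set.subset_union_right
  | since ρ M₁ M₂ ih₁ ih₂ | untl ρ M₁ M₂ ih₁ ih₂ =>
    rcases h with h | h | h
    · rw [Set.mem_singleton_iff] at h; subst h; rfl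
    · exact (ih₁ h).trans (Set.subset_union_left.trans Set.subset_union_right)
    · exact (ih₂ h).trans (Set.subset_union_right.trans Set.subset_union_right)

theorem terms_subset_of_mem_subatoms {M N : MAtom V τ} (h : N ∈ M.subatoms) :
    N.terms ⊆ M.terms := by
  induction M with
  | top | bot | rel => simp only [subatoms, Set.mem_singleton_iff] at h; subst h; rfl
  | diaMinus ρ M ih | diaPlus ρ M ih | boxMinus ρ M ih | boxPlus ρ M ih =>
    rcases h with h | h
    · rw [Set.mem_singleton_iff] at h; subst h; rfl
    · exact ih h
  | since ρ M₁ M₂ ih₁ ih₂ | untl ρ M₁ M₂ ih₁ ih₂ =>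
    rcases h with h | h | h
    · rw [Set.mem_singleton_iff] at h; subst h; rfl
    · exact (ih₁ h).trans Set.subset_union_left
    · exact (ih₂ h).trans Set.subset_union_right

theorem numbers_subset_of_mem_subatoms {M N : MAtom V τ} (h : N ∈ M.subatoms) :
    N.numbers ⊆ M.numbers := by
  induction M with
  | top | bot | rel => simp only [subatoms, Set.mem_singleton_iff] at h; subst h; rfl
  | diaMinus ρ M ih | diaPlus ρ M ih | boxMinus ρ M ih | boxPlus ρ M ih =>
    rcases h with h | h
    · rw [Set.mem_singleton_iff] at h; subst h; rfl
    · exact (ih h).trans Set.subset_union_right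
  | since ρ M₁ M₂ ih₁ ih₂ | untl ρ M₁ M₂ ih₁ ih₂ =>
    rcases h with h | h | h
    · rw [Set.mem_singleton_iff] at h; subst h; rfl
    · exact (ih₁ h).trans (Set.subset_union_left.trans Set.subset_union_right)
    · exact (ih₂ h).trans (Set.subset_union_right.trans Set.subset_union_right)

theorem IsPlain.isNormal {M : MAtom V τ} (h : M.IsPlain) : M.IsNormal := by
  cases M <;> simp_all [IsPlain, IsNormal]

theorem IsPlain.eq_of_mem_subatoms {M N : MAtom V τ} (h : M.IsPlain) (hN : N ∈ M.subatoms) :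
    N = M := by
  cases M <;> simp_all [IsPlain, subatoms]

theorem IsNormal.of_mem_subatoms {M N : MAtom V τ} (h : M.IsNormal) (hN : N ∈ M.subatoms) :
    N.IsNormal := by
  cases M with
  | top | bot | rel => simp only [subatoms, Set.mem_singleton_iff] at hN; subst hN; exact h
  | diaMinus ρ M | diaPlus ρ M => exact h.elim
  | boxMinus ρ M | boxPlus ρ M =>
    rcases hN with hN | hN
    · rw [Set.mem_singleton_iff] at hN; subst hN; exact h
    · rw [h.2.eq_of_mem_subatoms hN]; exact h.2.isNormal
  | since ρ M₁ M₂ | untl ρ M₁ M₂ =>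
    rcases hN with hN | hN | hN
    · rw [Set.mem_singleton_iff] at hN; subst hN; exact h
    · rw [h.2.1.eq_of_mem_subatoms hN]; exact h.2.1.isNormal
    · rw [h.2.2.eq_of_mem_subatoms hN]; exact h.2.2.isNormal

end MAtom

namespace Rule

theorem map_map (f : τ → τ') (g : τ' → τ'') (r : Rule V τ) :
    (r.map f).map g = r.map (g ∘ f) := by
  simp [map, MAtom.map_map, Function.comp_def]

theorem map_id (r : Rule V τ) : r.map id = r := by
  have h : MAtom.map (V := V) (id : τ → τ) = id := funext MAtom.map_id
  simp [map, h]

theorem Has.map {f : τ → τ'} {r : Rule V τ} {M : MAtom V τ} (h : r.Has M) :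
    (r.map f).Has (M.map f) := by
  rcases h with rfl | h | h
  · exact .inl rfl
  · exact .inr (.inl (List.mem_map_of_mem h))
  · exact .inr (.inr (List.mem_map_of_mem h))

theorem has_map {f : τ → τ'} {r : Rule V τ} {N : MAtom V τ'} (h : (r.map f).Has N) :
    ∃ M, r.Has M ∧ M.map f = N := by
  rcases h with rfl | h | h
  · exact ⟨r.head, .inl rfl, rfl⟩
  · obtain ⟨M, hM, rfl⟩ := List.mem_map.1 h
    exact ⟨M, .inr (.inl hM), rfl⟩
  · obtain ⟨M, hM, rfl⟩ := List.mem_map.1 h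
    exact ⟨M, .inr (.inr hM), rfl⟩

theorem IsNormal.has {r : Rule V τ} (h : r.IsNormal) {M : MAtom V τ} (hM : r.Has M) :
    M.IsNormal := by
  rcases hM with rfl | hM | hM
  · rcases h.1 with ⟨A, hA⟩ | hA <;> rw [hA] <;> trivial
  · exact h.2.1 M hM
  · exact h.2.2 M hM

end Rule

end SyntacticLemmas

/-! ### The closure of a program and a dataset -/

section Closure

variable {V : Vocabulary.{u, v, w}} {Pr : Program V} {D : Dataset V}

theorem exists_rule_atom {g : Rule V V.Const} (hg : g ∈ Pr.ground) {M : MAtom V V.Const}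
    (hM : g.Has M) : ∃ r ∈ Pr.rules, ∃ N, r.Has N ∧ N.numbers = M.numbers ∧
      (N.IsNormal ↔ M.IsNormal) := by
  obtain ⟨r, hr, θ, hθ⟩ := hg
  have h := hM.map (f := (Sum.inl : V.Const → V.Const ⊕ V.Var))
  rw [← hθ] at h
  obtain ⟨N, hN, hNM⟩ := Rule.has_map h
  refine ⟨r, hr, N, hN, ?_, ?_⟩
  · rw [← MAtom.numbers_map (Sum.elim Sum.inl θ), hNM, MAtom.numbers_map]
  · rw [← MAtom.isNormal_map (Sum.elim Sum.inl θ), hNM, MAtom.isNormal_map]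

theorem mem_atoms_of_has {g : Rule V V.Const} (hg : g ∈ groundOn Pr D) {M : MAtom V V.Const}
    (hM : g.Has M) : M ∈ atoms Pr D :=
  .inr (.inl ⟨g, hg, M, hM, M.mem_subatoms_self⟩)

theorem terms_subset_of_mem_atoms {M : MAtom V V.Const} (hM : M ∈ atoms Pr D) :
    M.terms ⊆ constants Pr D := by
  have key : ∀ g ∈ groundOn Pr D, ∀ M ∈ g.subatoms, M.terms ⊆ constants Pr D := by
    rintro g hg M ⟨N, hN, hMN⟩ c hc
    exact hg.2 ⟨N, hN, MAtom.terms_subset_of_mem_subatoms hMN hc⟩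
  rcases hM with ⟨f, hf, rfl⟩ | ⟨g, hg, hM⟩ | ⟨A, ⟨g, hg, hA⟩, rfl | rfl⟩
  · exact fun c hc => .inr ⟨f, hf, hc⟩
  · exact key g hg M hM
  · exact key g hg (MAtom.rel A) hA
  · exact key g hg (MAtom.rel A) hA

theorem subatoms_subset_atoms {M : MAtom V V.Const} (hM : M ∈ atoms Pr D) :
    M.subatoms ⊆ atoms Pr D := by
  have key : ∀ A, Mentioned Pr D A → ({MAtom.rel A} : Set (MAtom V V.Const)) ⊆ atoms Pr D := by
    rintro A ⟨g, hg, hA⟩ N rfl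
    exact .inr (.inl ⟨g, hg, hA⟩)
  rcases hM with ⟨f, hf, rfl⟩ | ⟨g, hg, N, hN, hM⟩ | ⟨A, hA, h⟩
  · rintro N rfl
    exact .inl ⟨f, hf, rfl⟩
  · exact fun N' hN' => .inr (.inl ⟨g, hg, N, hN, MAtom.subatoms_subset hM hN'⟩)
  · have hM : M ∈ atoms Pr D := .inr (.inr ⟨A, hA, h⟩)
    rcases h with rfl | rfl <;>
    · rintro N (rfl | hN)
      · exact hM
      · exact key A hA hN

theorem isNormal_of_mem_atoms (hnorm : Pr.Normalised) {M : MAtom V V.Const}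
    (hM : M ∈ atoms Pr D) : M.IsNormal := by
  rcases hM with ⟨f, hf, rfl⟩ | ⟨g, hg, N, hN, hM⟩ | ⟨A, -, rfl | rfl⟩
  · trivial
  · obtain ⟨r, hr, N', hN', -, h⟩ := exists_rule_atom hg.1 hN
    exact (h.1 ((hnorm r hr).has hN')).of_mem_subatoms hM
  · exact ⟨.inr rfl, trivial⟩
  · exact ⟨.inr rfl, trivial⟩

theorem Interval.finite_numbers (ρ : Interval) : ρ.numbers.Finite := by
  have h : ρ.numbers = {n | IsLeast ρ.carrier n} ∪ {n | IsGreatest ρ.carrier n} := rfl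
  rw [h]
  exact (Set.Subsingleton.finite fun _ ha _ hb => ha.unique hb).union
    (Set.Subsingleton.finite fun _ ha _ hb => ha.unique hb)

theorem MAtom.finite_numbers {τ : Type*} (M : MAtom V τ) : M.numbers.Finite := by
  induction M <;> simp_all [MAtom.numbers, Interval.finite_numbers]

theorem finite_posNumbers (Pr : Program V) : (posNumbers Pr).Finite := by
  have h : (⋃ r ∈ Pr.rules, ⋃ M ∈ {M | r.Has M}, M.numbers).Finite := by
    refine Set.Finite.biUnion Pr.rules.finite_toSet fun r _ => Set.Finite.biUnion ?_
      fun M _ => M.finite_numbers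
    refine ((Set.finite_singleton r.head).union
      (r.pos.finite_toSet.union r.neg.finite_toSet)).subset ?_
    exact fun M hM => hM
  refine h.subset ?_
  rintro n ⟨-, r, hr, M, hM, hn⟩
  simp only [Set.mem_iUnion]
  exact ⟨r, hr, M, hM, hn⟩

theorem one_le_tProg (Pr : Program V) : 1 ≤ tProg Pr := by
  unfold tProg
  split_ifs with h
  · exact (h.csSup_mem (finite_posNumbers Pr)).1
  · exact le_rfl

theorem le_tProg {r : Rule V (V.Const ⊕ V.Var)} (hr : r ∈ Pr.rules) {n : ℤ}
    (hn : n ∈ r.numbers) : n ≤ tProg Pr := by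
  rcases le_or_gt n 0 with h | h
  · linarith [one_le_tProg Pr]
  · have hmem : n ∈ posNumbers Pr := ⟨h, r, hr, hn⟩
    unfold tProg
    rw [if_pos ⟨n, hmem⟩]
    exact le_csSup (finite_posNumbers Pr).bddAbove hmem

theorem le_tProg_of_mem_atoms {M : MAtom V V.Const} (hM : M ∈ atoms Pr D) {n : ℤ}
    (hn : n ∈ M.numbers) : n ≤ tProg Pr := by
  have hunb : ∀ n ∈ NNInterval.unb.numbers, n ≤ tProg Pr := by
    rintro n (hn | hn)
    · have : n ≤ 0 := hn.2 (show (0 : ℤ) ≤ 0 from le_rfl)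
      linarith [one_le_tProg Pr]
    · have : n + 1 ≤ n := hn.2 (show (0 : ℤ) ≤ n + 1 from by
        have : (0 : ℤ) ≤ n := hn.1
        linarith)
      linarith
  rcases hM with ⟨f, hf, rfl⟩ | ⟨g, hg, N, hN, hM⟩ | ⟨A, -, rfl | rfl⟩
  · exact hn.elim
  · obtain ⟨r, hr, N', hN', h, -⟩ := exists_rule_atom hg.1 hN
    exact le_tProg hr ⟨N', hN', h ▸ MAtom.numbers_subset_of_mem_subatoms hM hn⟩
  · exact hunb n (hn.elim id False.elim)
  · exact hunb n (hn.elim id False.elim)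

/-- Bounded intervals in the closure lie in `[0, tProg]`. -/
theorem le_tProg_of_bounded {ρ : NNInterval} (hρ : ρ.Bounded)
    (h : ∀ n ∈ ρ.numbers, n ≤ tProg Pr) {t : ℤ} (ht : t ∈ ρ.carrier) : t ≤ tProg Pr :=
  (le_csSup hρ.2 ht).trans
    (h _ (.inr ⟨Int.csSup_mem ρ.nonempty hρ.2, fun _ hs => le_csSup hρ.2 hs⟩))

theorem finite_dataNumbers (D : Dataset V) : (dataNumbers D).Finite := by
  have h : (⋃ f ∈ D, f.interval.numbers).Finite :=
    Set.Finite.biUnion D.finite_toSet fun f _ => f.interval.finite_numbers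
  refine h.subset ?_
  rintro n ⟨f, hf, hn⟩
  simp only [Set.mem_iUnion]
  exact ⟨f, hf, hn⟩

theorem le_tMax {n : ℤ} (hn : n ∈ dataNumbers D) : n ≤ tMax D := by
  unfold tMax
  rw [if_pos ⟨n, hn⟩]
  exact le_csSup (finite_dataNumbers D).bddAbove hn

theorem tMin_le {n : ℤ} (hn : n ∈ dataNumbers D) : tMin D ≤ n := by
  unfold tMin
  rw [if_pos ⟨n, hn⟩]
  exact csInf_le (finite_dataNumbers D).bddBelow hn

theorem tMin_le_tMax (D : Dataset V) : tMin D ≤ tMax D := by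
  by_cases h : (dataNumbers D).Nonempty
  · obtain ⟨n, hn⟩ := h
    exact (tMin_le hn).trans (le_tMax hn)
  · simp [tMin, tMax, h]

end Closure

/-! ### Grounding over the constants of the program and the dataset -/

section Grounding

variable {V : Vocabulary.{u, v, w}} {Pr : Program V} {D : Dataset V}

/-- All relational atoms that hold in the interpretation belong to the closure. -/
def Within (Pr : Program V) (D : Dataset V) (I : Interp V) : Prop :=
  ∀ t, ∀ A ∈ I t, MAtom.rel A ∈ atoms Pr D

/-- The proviso on unguarded variables in the presence of further constants. -/
def FreshSafe (Pr : Program V) (D : Dataset V) : Prop :=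
  (∃ c : V.Const, c ∉ constants Pr D) →
    ∀ r ∈ Pr.rules, ∀ x : V.Var, Sum.inr x ∈ r.terms → ¬ r.Guarded x →
      (constants Pr D).Nonempty ∧
      ¬ ((∃ M, r.Has M ∧ Sum.inr x ∈ M.leftTerms) ∧ (∃ M ∈ r.neg, Sum.inr x ∈ M.terms))

theorem Within.mono {I J : Interp V} (h : I ≤ J) (hJ : Within Pr D J) : Within Pr D I :=
  fun t A hA => hJ t A (h t hA)

theorem Within.args {I : Interp V} (hI : Within Pr D I) (t : ℤ) (A : RelAtom V V.Const)
    (hA : A ∈ I t) : Set.range A.args ⊆ constants Pr D :=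
  terms_subset_of_mem_atoms (hI t A hA)

/-- Terms outside left operands of `since` and `untl` occur in atoms that have to hold. -/
theorem nonLeftTerms_subset_of_sat {K : Set V.Const} {I : Interp V}
    (hI : ∀ t, ∀ A ∈ I t, Set.range A.args ⊆ K) {M : MAtom V V.Const} {t : ℤ}
    (h : Sat I t M) : M.nonLeftTerms ⊆ K := by
  induction M generalizing t with
  | top | bot => exact Set.empty_subset _
  | rel A => exact hI t A h
  | diaMinus ρ M ih | diaPlus ρ M ih =>
    obtain ⟨t', -, h'⟩ := h
    exact ih h'
  | boxMinus ρ M ih =>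
    obtain ⟨n, hn⟩ := ρ.nonempty
    exact ih (h (t - n) (by simpa using hn))
  | boxPlus ρ M ih =>
    obtain ⟨n, hn⟩ := ρ.nonempty
    exact ih (h (t + n) (by simpa using hn))
  | since ρ M₁ M₂ _ ih | untl ρ M₁ M₂ _ ih =>
    obtain ⟨t', -, h', -⟩ := h
    exact ih h'

/-- Renaming only constants that never hold preserves satisfaction. -/
theorem sat_map_of_sat_map {τ : Type*} {K : Set V.Const} {I : Interp V}
    (hI : ∀ t, ∀ A ∈ I t, Set.range A.args ⊆ K) {f f' : τ → V.Const}
    (hf : ∀ s, f s ∈ K → f' s = f s) {M : MAtom V τ} {t : ℤ}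
    (h : Sat I t (M.map f)) : Sat I t (M.map f') := by
  induction M generalizing t with
  | top => trivial
  | bot => exact h
  | rel A =>
    have hA : A.map f' = A.map f := by
      simp only [RelAtom.map, RelAtom.mk.injEq, heq_eq_eq, true_and]
      exact funext fun i => hf _ (hI t _ h ⟨i, rfl⟩)
    simpa only [MAtom.map, hA] using h
  | diaMinus ρ M ih | diaPlus ρ M ih =>
    obtain ⟨t', ht, h'⟩ := h
    exact ⟨t', ht, ih h'⟩
  | boxMinus ρ M ih | boxPlus ρ M ih => exact fun t' ht => ih (h t' ht)
  | since ρ M₁ M₂ ih₁ ih₂ | untl ρ M₁ M₂ ih₁ ih₂ =>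
    obtain ⟨t', ht, h', h''⟩ := h
    exact ⟨t', ht, ih₂ h', fun s hs hs' => ih₁ (h'' s hs hs')⟩

theorem Sat.mono {I J : Interp V} (hIJ : I ≤ J) {M : MAtom V V.Const} {t : ℤ}
    (h : Sat I t M) : Sat J t M := by
  induction M generalizing t with
  | top => trivial
  | bot => exact h
  | rel A => exact hIJ t h
  | diaMinus ρ M ih | diaPlus ρ M ih =>
    obtain ⟨t', ht, h'⟩ := h
    exact ⟨t', ht, ih h'⟩
  | boxMinus ρ M ih | boxPlus ρ M ih => exact fun t' ht => ih (h t' ht)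
  | since ρ M₁ M₂ ih₁ ih₂ | untl ρ M₁ M₂ ih₁ ih₂ =>
    obtain ⟨t', ht, h', h''⟩ := h
    exact ⟨t', ht, ih₂ h', fun s hs hs' => ih₁ (h'' s hs hs')⟩

theorem groundOn_of_forall_mem (h : ∀ c : V.Const, c ∈ constants Pr D)
    {g : Rule V V.Const} (hg : g ∈ Pr.ground) : g ∈ groundOn Pr D :=
  ⟨hg, fun c _ => h c⟩

/-- Once there is a constant, ground instances come from total assignments of constants. -/
theorem mem_ground_iff (c : V.Const) {g : Rule V V.Const} :
    g ∈ Pr.ground ↔ ∃ r ∈ Pr.rules, ∃ σ : V.Var → V.Const, g = r.map (Sum.elim id σ) := by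
  constructor
  · rintro ⟨r, hr, θ, h⟩
    refine ⟨r, hr, fun x => Sum.elim id (fun _ => c) (θ x), ?_⟩
    have h' := congrArg (Rule.map (Sum.elim id fun _ => c)) h
    rw [Rule.map_map, Rule.map_map] at h'
    have h₁ : (Sum.elim id fun _ => c) ∘ (Sum.inl : V.Const → V.Const ⊕ V.Var) = id := rfl
    rw [h₁, Rule.map_id] at h'
    rw [← h']
    congr 1
    funext s
    cases s <;> rfl
  · rintro ⟨r, hr, σ, rfl⟩
    refine ⟨r, hr, fun x => .inl (σ x), ?_⟩
    rw [Rule.map_map]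
    congr 1
    funext s
    cases s <;> rfl

/-- A variable that is guarded by an atom whose terms outside left operands are known
is itself assigned a known constant. -/
theorem assign_mem_of_guarded {r : Rule V (V.Const ⊕ V.Var)} {σ : V.Var → V.Const}
    {K : Set V.Const} (h : ∀ M ∈ r.pos, (M.map (Sum.elim id σ)).nonLeftTerms ⊆ K)
    {x : V.Var} (hx : r.Guarded x) : σ x ∈ K := by
  obtain ⟨M, hM, hx⟩ := hx
  apply h M hM
  rw [MAtom.nonLeftTerms_map]
  exact ⟨_, hx, rfl⟩

theorem map_head_congr {r : Rule V (V.Const ⊕ V.Var)} (hr : r ∈ Pr.rules)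
    {σ σ' : V.Var → V.Const} {K : Set V.Const}
    (h : ∀ M ∈ r.pos, (M.map (Sum.elim id σ)).nonLeftTerms ⊆ K)
    (hσ : ∀ x, σ x ∈ K → σ' x = σ x) :
    r.head.map (Sum.elim id σ') = r.head.map (Sum.elim id σ) := by
  apply MAtom.map_congr
  rintro (c | x) hx
  · rfl
  · exact hσ x (assign_mem_of_guarded h (Pr.safe r hr x hx))

/-- If the constants outside left operands of the positive body are known, then the remaining
ones can be replaced so that the instance mentions known constants only. -/
theorem exists_known_instance (hfresh : FreshSafe Pr D) {c : V.Const}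
    (hc : c ∉ constants Pr D) {r : Rule V (V.Const ⊕ V.Var)} (hr : r ∈ Pr.rules)
    {σ : V.Var → V.Const}
    (h : ∀ M ∈ r.pos, (M.map (Sum.elim id σ)).nonLeftTerms ⊆ constants Pr D) :
    ∃ σ' : V.Var → V.Const, (∀ x, σ x ∈ constants Pr D → σ' x = σ x) ∧
      r.map (Sum.elim id σ') ∈ groundOn Pr D := by
  have key : ∀ σ' : V.Var → V.Const, (∀ x, Sum.inr x ∈ r.terms → σ' x ∈ constants Pr D) →
      r.map (Sum.elim id σ') ∈ groundOn Pr D := by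
    refine fun σ' hσ' => ⟨(mem_ground_iff c).2 ⟨r, hr, σ', rfl⟩, ?_⟩
    rintro d ⟨N, hN, hd⟩
    obtain ⟨M, hM, rfl⟩ := Rule.has_map hN
    rw [MAtom.terms_map] at hd
    obtain ⟨s | x, hs, rfl⟩ := hd
    · exact .inl ⟨r, hr, M, hM, hs⟩
    · exact hσ' x ⟨M, hM, hs⟩
  by_cases hx : ∃ x, Sum.inr x ∈ r.terms ∧ σ x ∉ constants Pr D
  · obtain ⟨x, hx, hσx⟩ := hx
    obtain ⟨⟨a, ha⟩, -⟩ := hfresh ⟨c, hc⟩ r hr x hx fun hg => hσx (assign_mem_of_guarded h hg)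
    classical
    refine ⟨fun y => if σ y ∈ constants Pr D then σ y else a, fun y hy => if_pos hy,
      key _ fun y _ => ?_⟩
    by_cases hy : σ y ∈ constants Pr D <;> simp [hy, ha]
  · push Not at hx
    exact ⟨σ, fun _ _ => rfl, key σ hx⟩

theorem head_mem_atoms (hfresh : FreshSafe Pr D) {g : Rule V V.Const} (hg : g ∈ Pr.ground)
    (h : ∀ M ∈ g.pos, M.nonLeftTerms ⊆ constants Pr D) : g.head ∈ atoms Pr D := by
  by_cases hc : ∃ c : V.Const, c ∉ constants Pr D
  · obtain ⟨c, hc⟩ := hc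
    obtain ⟨r, hr, σ, rfl⟩ := (mem_ground_iff c).1 hg
    have h' : ∀ M ∈ r.pos, (M.map (Sum.elim id σ)).nonLeftTerms ⊆ constants Pr D :=
      fun M hM => h _ (List.mem_map_of_mem hM)
    obtain ⟨σ', hσ', hg'⟩ := exists_known_instance hfresh hc hr h'
    have hmem : r.head.map (Sum.elim id σ') ∈ atoms Pr D := mem_atoms_of_has hg' (.inl rfl)
    rw [map_head_congr hr h' hσ'] at hmem
    exact hmem
  · push Not at hc
    exact mem_atoms_of_has (groundOn_of_forall_mem hc hg) (.inl rfl)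

/-- All ground rules hold at `t` when atoms outside the closure are ignored, that is, taken to be
unsatisfied. -/
def SatWithin (Pr : Program V) (D : Dataset V) (X T : Interp V) (t : ℤ) : Prop :=
  ∀ g ∈ Pr.ground, (∀ M ∈ g.pos, M ∈ atoms Pr D ∧ Sat X t M) →
    (∀ M ∈ g.neg, ¬ (M ∈ atoms Pr D ∧ Sat T t M)) → g.head ∈ atoms Pr D ∧ Sat X t g.head

/-- Unknown constants in left operands of the positive body may be replaced by known ones, whereas
those in the negated body are left alone. -/
theorem SatWithin.sat_head (hfresh : FreshSafe Pr D) {X T : Interp V} (hX : Within Pr D X)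
    {t : ℤ} (h : SatWithin Pr D X T t) {g : Rule V V.Const} (hg : g ∈ Pr.ground)
    (hpos : ∀ M ∈ g.pos, Sat X t M) (hneg : ∀ M ∈ g.neg, ¬ Sat T t M) : Sat X t g.head := by
  by_cases hc : ∃ c : V.Const, c ∉ constants Pr D
  · obtain ⟨c, hc⟩ := hc
    obtain ⟨r, hr, σ, rfl⟩ := (mem_ground_iff c).1 hg
    have hpos' : ∀ M ∈ r.pos, Sat X t (M.map (Sum.elim id σ)) :=
      fun M hM => hpos _ (List.mem_map_of_mem hM)
    have hneg' : ∀ M ∈ r.neg, ¬ Sat T t (M.map (Sum.elim id σ)) :=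
      fun M hM => hneg _ (List.mem_map_of_mem hM)
    have hnl : ∀ M ∈ r.pos, (M.map (Sum.elim id σ)).nonLeftTerms ⊆ constants Pr D :=
      fun M hM => nonLeftTerms_subset_of_sat hX.args (hpos' M hM)
    obtain ⟨σ', hσ', hg'⟩ := exists_known_instance hfresh hc hr hnl
    classical
    let σ'' : V.Var → V.Const := fun x => if ∃ M ∈ r.neg, Sum.inr x ∈ M.terms then σ x else σ' x
    have hσ'' : ∀ x, σ x ∈ constants Pr D → σ'' x = σ x := by
      intro x hx
      by_cases hn : ∃ M ∈ r.neg, Sum.inr x ∈ M.terms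
      · exact if_pos hn
      · exact (if_neg hn).trans (hσ' x hx)
    have hhead := map_head_congr hr hnl hσ''
    have hp : ∀ M ∈ r.pos, M.map (Sum.elim id σ'') = M.map (Sum.elim id σ') := by
      intro M hM
      apply MAtom.map_congr
      rintro (d | x) hx
      · rfl
      by_cases hn : ∃ M ∈ r.neg, Sum.inr x ∈ M.terms
      · have hK : σ x ∈ constants Pr D := by
          by_contra hK
          have hgd : ¬ r.Guarded x := fun hgd => hK (assign_mem_of_guarded hnl hgd)
          refine (hfresh ⟨c, hc⟩ r hr x ⟨M, .inr (.inl hM), hx⟩ hgd).2 ⟨⟨M, .inr (.inl hM), ?_⟩, hn⟩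
          exact (MAtom.mem_left_or_nonLeft hx).resolve_right fun hx => hgd ⟨M, hM, hx⟩
        exact (hσ'' x hK).trans (hσ' x hK).symm
      · exact if_neg hn
    have hn : ∀ M ∈ r.neg, M.map (Sum.elim id σ'') = M.map (Sum.elim id σ) := by
      intro M hM
      apply MAtom.map_congr
      rintro (d | x) hx
      · rfl
      · exact if_pos ⟨M, hM, hx⟩
    have key := h (r.map (Sum.elim id σ'')) ((mem_ground_iff c).2 ⟨r, hr, σ'', rfl⟩) ?_ ?_
    · have hsat : Sat X t (r.head.map (Sum.elim id σ'')) := key.2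
      rw [hhead] at hsat
      exact hsat
    · intro N hN
      obtain ⟨M, hM, rfl⟩ := List.mem_map.1 hN
      rw [hp M hM]
      refine ⟨mem_atoms_of_has hg' (.inr (.inl (List.mem_map_of_mem hM))),
        sat_map_of_sat_map hX.args ?_ (hpos' M hM)⟩
      rintro (d | x) hx
      · rfl
      · exact hσ' x hx
    · intro N hN
      obtain ⟨M, hM, rfl⟩ := List.mem_map.1 hN
      rw [hn M hM]
      exact fun hM' => hneg' M hM hM'.2
  · push Not at hc
    have hg' := groundOn_of_forall_mem hc hg
    exact (h g hg (fun M hM => ⟨mem_atoms_of_has hg' (.inr (.inl hM)), hpos M hM⟩)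
      fun M hM hM' => hneg M hM hM'.2).2

/-- A negated body atom outside the closure has an unknown constant outside left operands, and is
therefore not satisfied. -/
theorem satWithin_of_forall (hfresh : FreshSafe Pr D) {X T : Interp V} (hT : Within Pr D T)
    {t : ℤ} (h : ∀ g ∈ Pr.ground, (∀ M ∈ g.pos, Sat X t M) → (∀ M ∈ g.neg, ¬ Sat T t M) →
      Sat X t g.head) : SatWithin Pr D X T t := by
  intro g hg hpos hneg
  have hnl' : ∀ M ∈ g.pos, M.nonLeftTerms ⊆ constants Pr D := fun M hM =>
    M.nonLeftTerms_subset_terms.trans (terms_subset_of_mem_atoms (hpos M hM).1)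
  refine ⟨head_mem_atoms hfresh hg hnl', h g hg (fun M hM => (hpos M hM).2) ?_⟩
  by_cases hc : ∃ c : V.Const, c ∉ constants Pr D
  · obtain ⟨c, hc⟩ := hc
    obtain ⟨r, hr, σ, rfl⟩ := (mem_ground_iff c).1 hg
    have hnl : ∀ M ∈ r.pos, (M.map (Sum.elim id σ)).nonLeftTerms ⊆ constants Pr D :=
      fun M hM => hnl' _ (List.mem_map_of_mem hM)
    obtain ⟨σ', hσ', hg'⟩ := exists_known_instance hfresh hc hr hnl
    intro N hN hsat
    obtain ⟨M, hM, rfl⟩ := List.mem_map.1 hN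
    refine hneg _ hN ⟨?_, hsat⟩
    have hM' : M.map (Sum.elim id σ') = M.map (Sum.elim id σ) := by
      apply MAtom.map_congr
      rintro (d | x) hx
      · rfl
      refine hσ' x (by_contra fun hK => ?_)
      have hgd : ¬ r.Guarded x := fun hgd => hK (assign_mem_of_guarded hnl hgd)
      have hl := (hfresh ⟨c, hc⟩ r hr x ⟨M, .inr (.inr hM), hx⟩ hgd).2
      rcases MAtom.mem_left_or_nonLeft hx with hx' | hx'
      · exact hl ⟨⟨M, .inr (.inr hM), hx'⟩, ⟨M, hM, hx⟩⟩
      · refine hK (nonLeftTerms_subset_of_sat hT.args hsat ?_)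
        rw [MAtom.nonLeftTerms_map]
        exact ⟨_, hx', rfl⟩
    rw [← hM']
    exact mem_atoms_of_has hg' (.inr (.inr (List.mem_map_of_mem hM)))
  · push Not at hc
    have hg' := groundOn_of_forall_mem hc hg
    exact fun M hM hsat => hneg M hM ⟨mem_atoms_of_has hg' (.inr (.inr hM)), hsat⟩

/-- By minimality, a stable model contains only atoms of the closure: dropping the others yields
an HT-model, since no rule can derive them from atoms of the closure. -/
theorem IsStableModel.within (hnorm : Pr.Normalised) (hfresh : FreshSafe Pr D) {T : Interp V}
    (hT : IsStableModel Pr D T) : Within Pr D T := by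
  let H : Interp V := fun t => {A | A ∈ T t ∧ MAtom.rel A ∈ atoms Pr D}
  have hHT : H ≤ T := fun t A hA => hA.1
  have hH : Within Pr D H := fun t A hA => hA.2
  suffices h : IsHTModel Pr D H T from fun t A hA => (hT.2.2 h t hA).2
  refine ⟨hHT, fun f hf t ht => ⟨hT.1.2.1 f hf t ht, .inl ⟨f, hf, rfl⟩⟩, fun g hg t => ?_⟩
  refine ⟨fun hpos hneg => ?_, (hT.1.2.2 g hg t).2⟩
  have hhead := (hT.1.2.2 g hg t).2 (fun M hM => (hpos M hM).mono hHT) hneg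
  have hmem : g.head ∈ atoms Pr D :=
    head_mem_atoms hfresh hg fun M hM => nonLeftTerms_subset_of_sat hH.args (hpos M hM)
  obtain ⟨r, hr, θ, hθ⟩ := hg
  have hθ' : r.head.map (Sum.elim Sum.inl θ) = g.head.map Sum.inl := congrArg Rule.head hθ
  have hcases : (∃ A, g.head = .rel A) ∨ g.head = .bot := by
    rcases (hnorm r hr).1 with ⟨A, hA⟩ | hA <;> rw [hA] at hθ' <;>
      cases hgh : g.head <;> simp_all [MAtom.map]
  rcases hcases with ⟨A, hA⟩ | hA <;> rw [hA] at hhead hmem ⊢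
  · exact ⟨hhead, hmem⟩
  · exact hhead

end Grounding

/-! ### From local consistency to satisfaction -/

section Recurrences

/-- The recurrence for `M₁ S M₂` with interval `[0, ∞)` has the intended solution once it is not
postponed forever into the past. -/
theorem since_iff_of_recurrence {S M₁ M₂ : ℤ → Prop}
    (hrec : ∀ t, S t ↔ M₂ t ∨ M₂ (t - 1) ∨ (M₁ (t - 1) ∧ S (t - 1)))
    (hacc : ∀ k : ℤ, ∃ t ≤ k, ¬ S t ∨ M₂ t) (t : ℤ) :
    S t ↔ ∃ t' ≤ t, M₂ t' ∧ ∀ s, t' < s → s < t → M₁ s := by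
  constructor
  · intro hS
    by_contra hno
    push Not at hno
    have key : ∀ n : ℕ, S (t - n) ∧ ∀ s, t - n ≤ s → s < t → M₁ s := by
      intro n
      induction n with
      | zero => exact ⟨by simpa using hS, fun s h h' => absurd h (by simp; omega)⟩
      | succ n ih =>
        have h₁ : ¬ M₂ (t - n) := fun h => by
          obtain ⟨s, hs, hs', hM⟩ := hno (t - n) (by omega) h
          exact hM (ih.2 s hs.le hs')
        have h₂ : ¬ M₂ (t - n - 1) := fun h => by
          obtain ⟨s, hs, hs', hM⟩ := hno (t - n - 1) (by omega) h
          exact hM (ih.2 s (by omega) hs')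
        obtain ⟨hM, hS⟩ := (((hrec _).1 ih.1).resolve_left h₁).resolve_left h₂
        have he : t - ((n + 1 : ℕ) : ℤ) = t - n - 1 := by push_cast; ring
        rw [he]
        refine ⟨hS, fun s hs hs' => ?_⟩
        rcases eq_or_lt_of_le hs with rfl | hs
        · exact hM
        · exact ih.2 s (by omega) hs'
    obtain ⟨s, hs, h⟩ := hacc t
    obtain ⟨n, rfl⟩ : ∃ n : ℕ, s = t - n := ⟨(t - s).toNat, by omega⟩
    rcases h with h | h
    · exact h (key n).1
    · obtain ⟨s, hs, hs', hM⟩ := hno (t - n) (by omega) h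
      exact hM ((key n).2 s hs.le hs')
  · rintro ⟨t', ht', h₂, h₁⟩
    induction t, ht' using Int.leInduction with
    | base => exact (hrec _).2 (.inl h₂)
    | succ m hm ih =>
      rw [hrec, add_sub_cancel_right]
      rcases eq_or_lt_of_le hm with rfl | hlt
      · exact .inr (.inl h₂)
      · exact .inr (.inr ⟨h₁ m hlt (by omega), ih fun s hs hs' => h₁ s hs (by omega)⟩)

/-- The recurrence for `□⁻ M` with interval `[0, ∞)` has the intended solution once it does not
stay false throughout a past in which `M` always holds. -/
theorem box_iff_of_recurrence {B M : ℤ → Prop}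
    (hrec : ∀ t, B t ↔ M t ∧ B (t - 1))
    (hacc : ∀ k : ℤ, ∃ t ≤ k, B t ∨ ¬ M t) (t : ℤ) :
    B t ↔ ∀ t' ≤ t, M t' := by
  have down : ∀ t, B t → ∀ n : ℕ, B (t - n) := by
    intro t hB n
    induction n with
    | zero => simpa using hB
    | succ n ih =>
      have he : t - ((n + 1 : ℕ) : ℤ) = t - n - 1 := by push_cast; ring
      rw [he]
      exact ((hrec _).1 ih).2
  constructor
  · intro hB t' ht'
    have h := down t hB (t - t').toNat
    rw [show t - ((t - t').toNat : ℤ) = t' by omega] at h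
    exact ((hrec _).1 h).1
  · intro hM
    obtain ⟨s, hs, h⟩ := hacc t
    have hBs : B s := h.resolve_right (not_not_intro (hM s hs))
    induction t, hs using Int.leInduction with
    | base => exact hBs
    | succ m hm ih =>
      rw [hrec, add_sub_cancel_right]
      exact ⟨hM _ le_rfl, ih fun t' ht' => hM t' (by omega)⟩

end Recurrences

section Tracks

variable {V : Vocabulary.{u, v, w}} {Pr : Program V} {D : Dataset V}

/-- Sets of facts over the whole timeline that look like an interpretation in every interval of
length `L`, and in which no unbounded operator is postponed forever in its direction. -/
structure IsTrack (Pr : Program V) (D : Dataset V) (L : ℤ) (F : Set (TimedAtom V)) : Prop where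
  mem_atoms : ∀ p ∈ F, p.1 ∈ atoms Pr D
  realised : ∀ s, WTuple.Realised Pr D s (s + L) F
  box : ∀ (d : Dir) M, d.box M ∈ atoms Pr D → ∀ k : ℤ, ∃ t, k ≤ d.step * t ∧
    ((d.box M, t) ∈ F ∨ (M, t) ∉ F)
  reach : ∀ (d : Dir) M₁ M₂, d.reach M₁ M₂ ∈ atoms Pr D → ∀ k : ℤ, ∃ t, k ≤ d.step * t ∧
    ((d.reach M₁ M₂, t) ∉ F ∨ (M₂, t) ∈ F)

/-- The interpretation consisting of the relational facts of `F`. -/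
def interpOf (F : Set (TimedAtom V)) : Interp V := fun t => {A | (MAtom.rel A, t) ∈ F}

theorem mem_unb {t : ℤ} : t ∈ NNInterval.unb.carrier ↔ 0 ≤ t := Iff.rfl

variable {L : ℤ} {F : Set (TimedAtom V)}

theorem IsTrack.within (hF : IsTrack Pr D L F) : Within Pr D (interpOf F) :=
  fun _ _ hA => hF.mem_atoms _ hA

theorem IsTrack.sat_iff_of_isPlain (hF : IsTrack Pr D L F) (hL : 0 ≤ L) {M : MAtom V V.Const}
    (hM : M ∈ atoms Pr D) (hp : M.IsPlain) (t : ℤ) : Sat (interpOf F) t M ↔ (M, t) ∈ F := by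
  obtain ⟨J, hJ⟩ := hF.realised t
  have h := hJ M hM t ⟨le_rfl, by omega⟩
  cases M with
  | top | bot => exact h.symm
  | rel A => exact Iff.rfl
  | _ => exact hp.elim

/-- A track contains exactly those facts over the closure that hold in its interpretation. -/
theorem IsTrack.sat_iff (hnorm : Pr.Normalised) (hF : IsTrack Pr D L F) (hL : tProg Pr ≤ L)
    {M : MAtom V V.Const} (hM : M ∈ atoms Pr D) (t : ℤ) :
    Sat (interpOf F) t M ↔ (M, t) ∈ F := by
  have hL₁ : 1 ≤ L := (one_le_tProg Pr).trans hL
  have hn := isNormal_of_mem_atoms hnorm hM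
  have hsub := subatoms_subset_atoms hM
  have hnum : ∀ n ∈ M.numbers, n ≤ tProg Pr := fun n hn => le_tProg_of_mem_atoms hM hn
  cases M with
  | top | bot | rel => exact hF.sat_iff_of_isPlain (by omega) hM trivial t
  | diaMinus ρ M | diaPlus ρ M => exact hn.elim
  | boxMinus ρ N =>
    have hN : N ∈ atoms Pr D := hsub (.inr N.mem_subatoms_self)
    have hs := fun t => hF.sat_iff_of_isPlain (by omega) hN hn.2 t
    rcases hn.1 with hb | rfl
    · obtain ⟨J, hJ⟩ := hF.realised (t - L)
      rw [hJ _ hM t ⟨by omega, by omega⟩]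
      refine forall_congr' fun t' => imp_congr_right fun ht' => ?_
      have h₁ := le_tProg_of_bounded hb (fun n hn => hnum n (.inl hn)) ht'
      have h₂ := ρ.nonneg _ ht'
      rw [hs, hJ _ hN t' ⟨by omega, by omega⟩]
    · symm
      refine (box_iff_of_recurrence (B := fun t => (MAtom.boxMinus .unb N, t) ∈ F)
        (M := fun t => (N, t) ∈ F) (fun t => ?_) (fun k => ?_) t).trans ?_
      · obtain ⟨J, hJ⟩ := hF.realised (t - L)
        rw [hJ _ hM t ⟨by omega, by omega⟩, hJ _ hM (t - 1) ⟨by omega, by omega⟩,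
          hJ _ hN t ⟨by omega, by omega⟩]
        simp only [Sat, mem_unb]
        refine ⟨fun h => ⟨h t (by omega), fun t' ht' => h t' (by omega)⟩, fun h t' ht' => ?_⟩
        rcases eq_or_ne t' t with rfl | hne
        · exact h.1
        · exact h.2 t' (by omega)
      · obtain ⟨s, hs, h⟩ := hF.box .left N hM (-k)
        exact ⟨s, by simp only [Dir.step] at hs; omega, h⟩
      · simp only [Sat, mem_unb, hs, sub_nonneg]
  | boxPlus ρ N =>
    have hN : N ∈ atoms Pr D := hsub (.inr N.mem_subatoms_self)
    have hs := fun t => hF.sat_iff_of_isPlain (by omega) hN hn.2 t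
    rcases hn.1 with hb | rfl
    · obtain ⟨J, hJ⟩ := hF.realised t
      rw [hJ _ hM t ⟨by omega, by omega⟩]
      refine forall_congr' fun t' => imp_congr_right fun ht' => ?_
      have h₁ := le_tProg_of_bounded hb (fun n hn => hnum n (.inl hn)) ht'
      have h₂ := ρ.nonneg _ ht'
      rw [hs, hJ _ hN t' ⟨by omega, by omega⟩]
    · -- time is reversed to apply the recurrence for the past operator
      symm
      have h := box_iff_of_recurrence (B := fun t => (MAtom.boxPlus .unb N, -t) ∈ F)
        (M := fun t => (N, -t) ∈ F) (fun t => ?_) (fun k => ?_) (-t)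
      · simp only [neg_neg] at h
        rw [h]
        simp only [Sat, mem_unb, hs, sub_nonneg]
        exact ⟨fun h t' ht' => by simpa using h (-t') (by omega), fun h t' ht' => h _ (by omega)⟩
      · obtain ⟨J, hJ⟩ := hF.realised (-t)
        rw [hJ _ hM (-t) ⟨by omega, by omega⟩, hJ _ hM (-(t - 1)) ⟨by omega, by omega⟩,
          hJ _ hN (-t) ⟨by omega, by omega⟩]
        simp only [Sat, mem_unb]
        refine ⟨fun h => ⟨h _ (by omega), fun t' ht' => h t' (by omega)⟩, fun h t' ht' => ?_⟩
        rcases eq_or_ne t' (-t) with rfl | hne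
        · exact h.1
        · exact h.2 t' (by omega)
      · obtain ⟨s, hs, h⟩ := hF.box .right N hM (-k)
        exact ⟨-s, by simp only [Dir.step] at hs; omega, by rw [neg_neg]; exact h⟩
  | since ρ M₁ M₂ =>
    have hM₁ : M₁ ∈ atoms Pr D := hsub (.inr (.inl M₁.mem_subatoms_self))
    have hM₂ : M₂ ∈ atoms Pr D := hsub (.inr (.inr M₂.mem_subatoms_self))
    have hs₁ := fun t => hF.sat_iff_of_isPlain (by omega) hM₁ hn.2.1 t
    have hs₂ := fun t => hF.sat_iff_of_isPlain (by omega) hM₂ hn.2.2 t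
    rcases hn.1 with hb | rfl
    · obtain ⟨J, hJ⟩ := hF.realised (t - L)
      rw [hJ _ hM t ⟨by omega, by omega⟩]
      refine exists_congr fun t' => and_congr_right fun ht' => ?_
      have h₁ := le_tProg_of_bounded hb (fun n hn => hnum n (.inl hn)) ht'
      have h₂ := ρ.nonneg _ ht'
      rw [hs₂, hJ _ hM₂ t' ⟨by omega, by omega⟩]
      refine and_congr_right fun _ => forall_congr' fun s => forall_congr' fun hs =>
        forall_congr' fun hs' => ?_
      rw [hs₁, hJ _ hM₁ s ⟨by omega, by omega⟩]
    · symm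
      refine (since_iff_of_recurrence (S := fun t => (MAtom.since .unb M₁ M₂, t) ∈ F)
        (M₁ := fun t => (M₁, t) ∈ F) (M₂ := fun t => (M₂, t) ∈ F)
        (fun t => ?_) (fun k => ?_) t).trans ?_
      · obtain ⟨J, hJ⟩ := hF.realised (t - L)
        rw [hJ _ hM t ⟨by omega, by omega⟩, hJ _ hM (t - 1) ⟨by omega, by omega⟩,
          hJ _ hM₂ t ⟨by omega, by omega⟩, hJ _ hM₂ (t - 1) ⟨by omega, by omega⟩,
          hJ _ hM₁ (t - 1) ⟨by omega, by omega⟩]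
        simp only [Sat, mem_unb]
        constructor
        · rintro ⟨t', ht', h₂, h₁⟩
          rcases eq_or_ne t' t with rfl | hne
          · exact .inl h₂
          rcases eq_or_ne t' (t - 1) with rfl | hne'
          · exact .inr (.inl h₂)
          · exact .inr (.inr ⟨h₁ _ (by omega) (by omega), t', by omega, h₂,
              fun s hs hs' => h₁ s hs (by omega)⟩)
        · rintro (h | h | ⟨h, t', ht', h₂, h₁⟩)
          · exact ⟨t, by omega, h, fun s hs hs' => absurd hs' (by omega)⟩
          · exact ⟨t - 1, by omega, h, fun s hs hs' => absurd hs' (by omega)⟩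
          · refine ⟨t', by omega, h₂, fun s hs hs' => ?_⟩
            rcases eq_or_ne s (t - 1) with rfl | hne
            · exact h
            · exact h₁ s hs (by omega)
      · obtain ⟨s, hs, h⟩ := hF.reach .left M₁ M₂ hM (-k)
        exact ⟨s, by simp only [Dir.step] at hs; omega, h⟩
      · simp only [Sat, mem_unb, hs₁, hs₂, sub_nonneg]
  | untl ρ M₁ M₂ =>
    have hM₁ : M₁ ∈ atoms Pr D := hsub (.inr (.inl M₁.mem_subatoms_self))
    have hM₂ : M₂ ∈ atoms Pr D := hsub (.inr (.inr M₂.mem_subatoms_self))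
    have hs₁ := fun t => hF.sat_iff_of_isPlain (by omega) hM₁ hn.2.1 t
    have hs₂ := fun t => hF.sat_iff_of_isPlain (by omega) hM₂ hn.2.2 t
    rcases hn.1 with hb | rfl
    · obtain ⟨J, hJ⟩ := hF.realised t
      rw [hJ _ hM t ⟨by omega, by omega⟩]
      refine exists_congr fun t' => and_congr_right fun ht' => ?_
      have h₁ := le_tProg_of_bounded hb (fun n hn => hnum n (.inl hn)) ht'
      have h₂ := ρ.nonneg _ ht'
      rw [hs₂, hJ _ hM₂ t' ⟨by omega, by omega⟩]
      refine and_congr_right fun _ => forall_congr' fun s => forall_congr' fun hs =>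
        forall_congr' fun hs' => ?_
      rw [hs₁, hJ _ hM₁ s ⟨by omega, by omega⟩]
    · -- time is reversed to apply the recurrence for the past operator
      symm
      have h := since_iff_of_recurrence (S := fun t => (MAtom.untl .unb M₁ M₂, -t) ∈ F)
        (M₁ := fun t => (M₁, -t) ∈ F) (M₂ := fun t => (M₂, -t) ∈ F)
        (fun t => ?_) (fun k => ?_) (-t)
      · simp only [neg_neg] at h
        rw [h]
        simp only [Sat, mem_unb, hs₁, hs₂, sub_nonneg]
        constructor
        · rintro ⟨t', ht', h₂, h₁⟩
          exact ⟨-t', by omega, h₂, fun s hs hs' => by simpa using h₁ (-s) (by omega) (by omega)⟩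
        · rintro ⟨t', ht', h₂, h₁⟩
          exact ⟨-t', by omega, by simpa using h₂, fun s hs hs' => h₁ _ (by omega) (by omega)⟩
      · obtain ⟨J, hJ⟩ := hF.realised (-t)
        rw [hJ _ hM (-t) ⟨by omega, by omega⟩, hJ _ hM (-(t - 1)) ⟨by omega, by omega⟩,
          hJ _ hM₂ (-t) ⟨by omega, by omega⟩, hJ _ hM₂ (-(t - 1)) ⟨by omega, by omega⟩,
          hJ _ hM₁ (-(t - 1)) ⟨by omega, by omega⟩]
        simp only [Sat, mem_unb]
        constructor
        · rintro ⟨t', ht', h₂, h₁⟩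
          rcases eq_or_ne t' (-t) with rfl | hne
          · exact .inl h₂
          rcases eq_or_ne t' (-(t - 1)) with rfl | hne'
          · exact .inr (.inl h₂)
          · exact .inr (.inr ⟨h₁ _ (by omega) (by omega), t', by omega, h₂,
              fun s hs hs' => h₁ s (by omega) hs'⟩)
        · rintro (h | h | ⟨h, t', ht', h₂, h₁⟩)
          · exact ⟨-t, by omega, h, fun s hs hs' => absurd hs' (by omega)⟩
          · exact ⟨-(t - 1), by omega, h, fun s hs hs' => absurd hs' (by omega)⟩
          · refine ⟨t', by omega, h₂, fun s hs hs' => ?_⟩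
            rcases eq_or_ne s (-(t - 1)) with rfl | hne
            · exact h
            · exact h₁ s (by omega) hs'
      · obtain ⟨s, hs, h⟩ := hF.reach .right M₁ M₂ hM (-k)
        exact ⟨-s, by simp only [Dir.step] at hs; omega, by rw [neg_neg]; exact h⟩

end Tracks

/-! ### Windows cut out of interpretations -/

section Facts

variable {V : Vocabulary.{u, v, w}} {Pr : Program V} {D : Dataset V}

/-- The facts over the closure that hold in `I` at the points of `[lo, hi]`. -/
def facts (Pr : Program V) (D : Dataset V) (I : Interp V) (lo hi : ℤ) : Set (TimedAtom V) :=
  {p | p.1 ∈ atoms Pr D ∧ p.2 ∈ Set.Icc lo hi ∧ Sat I p.2 p.1}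

/-- The letter that describes the point `t` of `I`. -/
def slice (Pr : Program V) (D : Dataset V) (I : Interp V) (t : ℤ) : Set (MAtom V V.Const) :=
  {M | M ∈ atoms Pr D ∧ Sat I t M}

theorem isHTModel_iff (hfresh : FreshSafe Pr D) {H T : Interp V} (hT : Within Pr D T) :
    IsHTModel Pr D H T ↔ H ≤ T ∧ ModelsData H D ∧
      ∀ t, SatWithin Pr D H T t ∧ SatWithin Pr D T T t := by
  refine and_congr_right fun hHT => and_congr_right fun _ => ⟨fun h t => ⟨?_, ?_⟩, fun h g hg t =>
    ⟨(h t).1.sat_head hfresh (hT.mono hHT) hg, (h t).2.sat_head hfresh hT hg⟩⟩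
  · exact satWithin_of_forall hfresh hT fun g hg => (h g hg t).1
  · exact satWithin_of_forall hfresh hT fun g hg => (h g hg t).2

theorem locallySatisfies_iff {H T : Interp V} {W : WTuple V}
    (hH : W.H = facts Pr D H W.lo W.hi) (hT : W.T = facts Pr D T W.lo W.hi) :
    W.LocallySatisfies Pr ↔
      ∀ t ∈ Set.Icc W.lo W.hi, SatWithin Pr D H T t ∧ SatWithin Pr D T T t := by
  have key : ∀ I : Interp V, ∀ t ∈ Set.Icc W.lo W.hi, ∀ M,
      (M, t) ∈ facts Pr D I W.lo W.hi ↔ M ∈ atoms Pr D ∧ Sat I t M :=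
    fun I t ht M => ⟨fun h => ⟨h.1, h.2.2⟩, fun h => ⟨h.1, ht, h.2⟩⟩
  unfold WTuple.LocallySatisfies
  rw [hH, hT]
  constructor
  · refine fun h t ht => ⟨fun g hg => ?_, fun g hg => ?_⟩
    · simpa only [key _ t ht] using (h g hg t ht).1
    · simpa only [key _ t ht] using (h g hg t ht).2
  · intro h g hg t ht
    simp only [key _ t ht]
    exact ⟨(h t ht).1 g hg, (h t ht).2 g hg⟩

theorem realised_facts (I : Interp V) (lo hi : ℤ) :
    WTuple.Realised Pr D lo hi (facts Pr D I lo hi) :=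
  ⟨I, fun _ hM _ ht => ⟨fun h => h.2.2, fun h => ⟨hM, ht, h⟩⟩⟩

theorem facts_mono {H T : Interp V} (h : H ≤ T) (lo hi : ℤ) :
    facts Pr D H lo hi ⊆ facts Pr D T lo hi :=
  fun _ hp => ⟨hp.1, hp.2.1, hp.2.2.mono h⟩

theorem isWindow_of_facts {H T : Interp V} (hHT : H ≤ T) {W : WTuple V} (hle : W.lo ≤ W.hi)
    (hH : W.H = facts Pr D H W.lo W.hi) (hT : W.T = facts Pr D T W.lo W.hi) :
    W.IsWindow Pr D := by
  refine ⟨hle, ?_, ?_, ?_, ?_⟩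
  · rw [hT]; exact fun p hp => ⟨hp.1, hp.2.1⟩
  · rw [hH, hT]; exact facts_mono hHT _ _
  · rw [hH]; exact realised_facts _ _ _
  · rw [hT]; exact realised_facts _ _ _

/-- Interpretations over the closure are determined by their windows of a fixed length. -/
theorem eq_of_facts_eq {H T : Interp V} (hH : Within Pr D H) (hT : Within Pr D T) {lo hi : ℤ}
    (hle : lo ≤ hi)
    (h : ∀ k, facts Pr D H (lo + k) (hi + k) = facts Pr D T (lo + k) (hi + k)) : H = T := by
  funext t
  ext A
  have ht : t ∈ Set.Icc (lo + (t - lo)) (hi + (t - lo)) := ⟨by omega, by omega⟩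
  constructor
  · intro hA
    have hmem : (MAtom.rel A, t) ∈ facts Pr D H (lo + (t - lo)) (hi + (t - lo)) :=
      ⟨hH t A hA, ht, hA⟩
    rw [h] at hmem
    exact hmem.2.2
  · intro hA
    have hmem : (MAtom.rel A, t) ∈ facts Pr D T (lo + (t - lo)) (hi + (t - lo)) :=
      ⟨hT t A hA, ht, hA⟩
    rw [← h] at hmem
    exact hmem.2.2

/-- The facts of one window, restricted and extended by one slice, are those of the next. -/
theorem facts_step (T : Interp V) (d : Dir) {W : WTuple V} (hle : W.lo ≤ W.hi)
    (hT : W.T = facts Pr D T W.lo W.hi) :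
    facts Pr D T (W.lo + d.step) (W.hi + d.step) =
      {p | p ∈ W.T ∧ p.2 ∈ Set.Icc (W.lo + d.step) (W.hi + d.step)} ∪
        {p | p.1 ∈ slice Pr D T (d.newPoint W) ∧ p.2 = d.newPoint W} := by
  rw [hT]
  ext ⟨M, t⟩
  constructor
  · rintro ⟨hM, ht, hs⟩
    by_cases hn : t = d.newPoint W
    · exact .inr ⟨⟨hM, hn ▸ hs⟩, hn⟩
    · refine .inl ⟨⟨hM, ?_, hs⟩, ht⟩
      cases d <;> simp only [Dir.step, Dir.newPoint, Set.mem_Icc] at * <;> omega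
  · rintro (⟨⟨hM, -, hs⟩, ht⟩ | ⟨⟨hM, hs⟩, rfl : t = _⟩)
    · exact ⟨hM, ht, hs⟩
    · refine ⟨hM, ?_, hs⟩
      cases d <;> simp only [Dir.step, Dir.newPoint, Set.mem_Icc] <;> omega

/-- The base window of a model of the data entails the data: an unbounded fact contains the
respective outermost mentioned number, at which the box operator over its atom is recorded. -/
theorem factsEntail_facts (hdata : ∀ f ∈ D, ¬ f.interval.Bounded → Mentioned Pr D f.atom)
    {H : Interp V} (hH : ModelsData H D) {hi : ℤ} (hhi : tMax D ≤ hi) :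
    FactsEntail (facts Pr D H (tMin D) hi) D := by
  intro I hI f hf t ht
  have hmem : MAtom.rel f.atom ∈ atoms Pr D := .inl ⟨f, hf, rfl⟩
  have hle := tMin_le_tMax D
  have hoc := f.interval.ordConnected
  rcases lt_or_ge t (tMin D) with h₁ | h₁
  · have hub : ¬ BddBelow f.interval.carrier := fun hb =>
      absurd ((tMin_le ⟨f, hf, .inl ⟨Int.csInf_mem f.interval.nonempty hb,
        fun _ hs => csInf_le hb hs⟩⟩).trans (csInf_le hb ht)) (by omega)
    have hmin : tMin D ∈ f.interval.carrier := by
      by_contra hno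
      have hb : BddAbove f.interval.carrier := by
        refine ⟨tMin D, fun s hs => le_of_not_gt fun hlt => hno ?_⟩
        exact hoc.out ht hs ⟨h₁.le, hlt.le⟩
      have hg := Int.csSup_mem f.interval.nonempty hb
      have h₂ := tMin_le ⟨f, hf, .inr ⟨hg, fun _ hs => le_csSup hb hs⟩⟩
      exact hno (hoc.out ht hg ⟨h₁.le, h₂⟩)
    have hbox : MAtom.boxMinus .unb (.rel f.atom) ∈ atoms Pr D :=
      .inr (.inr ⟨f.atom, hdata f hf fun hb => hub hb.1, .inl rfl⟩)
    have hsat : Sat I (tMin D) (.boxMinus .unb (.rel f.atom)) := by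
      refine hI (_, tMin D) ⟨hbox, ⟨le_rfl, hle.trans hhi⟩, fun t' ht' => hH f hf t' ?_⟩
      obtain ⟨s, hs, hlt⟩ := not_bddBelow_iff.1 hub t'
      exact hoc.out hs hmin ⟨hlt.le, sub_nonneg.1 ht'⟩
    exact hsat t (sub_nonneg.2 h₁.le)
  rcases le_or_gt t (tMax D) with h₂ | h₂
  · exact hI (.rel f.atom, t) ⟨hmem, ⟨h₁, h₂.trans hhi⟩, hH f hf t ht⟩
  · have hub : ¬ BddAbove f.interval.carrier := fun hb =>
      absurd ((le_csSup hb ht).trans (le_tMax ⟨f, hf, .inr ⟨Int.csSup_mem f.interval.nonempty hb,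
        fun _ hs => le_csSup hb hs⟩⟩)) (by omega)
    have hmax : tMax D ∈ f.interval.carrier := by
      by_contra hno
      have hb : BddBelow f.interval.carrier := by
        refine ⟨tMax D, fun s hs => le_of_not_gt fun hlt => hno ?_⟩
        exact hoc.out hs ht ⟨hlt.le, h₂.le⟩
      have hg := Int.csInf_mem f.interval.nonempty hb
      have h₃ := le_tMax ⟨f, hf, .inl ⟨hg, fun _ hs => csInf_le hb hs⟩⟩
      exact hno (hoc.out hg ht ⟨h₃, h₂.le⟩)
    have hbox : MAtom.boxPlus .unb (.rel f.atom) ∈ atoms Pr D :=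
      .inr (.inr ⟨f.atom, hdata f hf fun hb => hub hb.2, .inr rfl⟩)
    have hsat : Sat I (tMax D) (.boxPlus .unb (.rel f.atom)) := by
      refine hI (_, tMax D) ⟨hbox, ⟨hle, hhi⟩, fun t' ht' => hH f hf t' ?_⟩
      obtain ⟨s, hs, hlt⟩ := not_bddAbove_iff.1 hub t'
      exact hoc.out hmax hs ⟨sub_nonneg.1 ht', hlt.le⟩
    exact hsat t (sub_nonneg.2 h₂.le)

end Facts

/-! ### Two-sided runs -/

section BiRuns

variable {V : Vocabulary.{u, v, w}} {Pr : Program V} {D : Dataset V}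

theorem Dir.exists_eq (k : ℤ) : ∃ (d : Dir) (n : ℕ), k = d.step * n := by
  rcases le_total 0 k with h | h
  · exact ⟨.right, k.toNat, by simp [Dir.step, h]⟩
  · exact ⟨.left, (-k).toNat, by simp only [Dir.step]; omega⟩

/-- A run to the left and a run to the right from a common window, each satisfying the accepting
condition of the automaton `𝒜`. The window `W k` is the one displaced by `k`. -/
structure IsBiRun (Pr : Program V) (D : Dataset V) (w : Dir → ℕ → Set (MAtom V V.Const))
    (W : ℤ → WTuple V) : Prop where
  states : ∀ k, W k ∈ autStates Pr D (W 0)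
  trans : ∀ (d : Dir) (n : ℕ), W (d.step * (n + 1)) ∈ autTrans Pr D d (W (d.step * n)) (w d n)
  acc : ∀ (d : Dir), ∀ S ∈ autAcc Pr D d (W 0), ∃ᶠ n : ℕ in atTop, W (d.step * n) ∈ S

theorem exists_isBiRun {W₀ : WTuple V} {w : Dir → ℕ → Set (MAtom V V.Const)}
    {run : Dir → ℕ → WTuple V} (h₀ : ∀ d, run d 0 = W₀)
    (hs : ∀ d n, run d n ∈ autStates Pr D W₀)
    (ht : ∀ d n, run d (n + 1) ∈ autTrans Pr D d (run d n) (w d n))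
    (ha : ∀ d, ∀ S ∈ autAcc Pr D d W₀, ∃ᶠ n in atTop, run d n ∈ S) :
    ∃ W : ℤ → WTuple V, W 0 = W₀ ∧ IsBiRun Pr D w W ∧
      ∀ (d : Dir) (n : ℕ), W (d.step * n) = run d n := by
  obtain ⟨W, hW⟩ : ∃ W : ℤ → WTuple V, ∀ (d : Dir) (n : ℕ), W (d.step * n) = run d n := by
    refine ⟨fun k => match k with
      | .ofNat n => run .right n
      | .negSucc n => run .left (n + 1), ?_⟩
    rintro (_ | _) n
    · cases n with
      | zero => exact (h₀ .right).trans (h₀ .left).symm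
      | succ n =>
        have h : Dir.left.step * ((n + 1 : ℕ) : ℤ) = .negSucc n := by
          simp only [Dir.step]; omega
        rw [h]
    · have h : Dir.right.step * (n : ℤ) = .ofNat n := by simp [Dir.step]
      rw [h]
  have hW₀ : W 0 = W₀ := by simpa [h₀] using hW .left 0
  refine ⟨W, hW₀, ⟨fun k => ?_, fun d n => ?_, fun d S hS => ?_⟩, hW⟩
  · obtain ⟨d, n, rfl⟩ := Dir.exists_eq k
    rw [hW, hW₀]
    exact hs d n
  · have h := hW d (n + 1)
    push_cast at h
    rw [h, hW]
    exact ht d n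
  · simp only [hW]
    exact ha d S (hW₀ ▸ hS)

variable {w : Dir → ℕ → Set (MAtom V V.Const)} {W : ℤ → WTuple V}

theorem IsBiRun.lo_eq (hW : IsBiRun Pr D w W) (k : ℤ) : (W k).lo = (W 0).lo + k := by
  obtain ⟨d, n, rfl⟩ := Dir.exists_eq k
  induction n with
  | zero => simp
  | succ n ih =>
    have h := (hW.trans d n).1
    push_cast
    rw [h, ih]
    ring

theorem IsBiRun.hi_eq (hW : IsBiRun Pr D w W) (k : ℤ) : (W k).hi = (W 0).hi + k := by
  have h₁ := (hW.states k).2.2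
  have h₂ := hW.lo_eq k
  omega

theorem IsBiRun.lo_le_hi (hW : IsBiRun Pr D w W) (k : ℤ) : (W k).lo ≤ (W k).hi :=
  (hW.states k).1.1

theorem IsBiRun.H_subset_T (hW : IsBiRun Pr D w W) (k : ℤ) : (W k).H ⊆ (W k).T :=
  (hW.states k).1.2.2.1

theorem IsBiRun.mem_T (hW : IsBiRun Pr D w W) {k : ℤ} {p : TimedAtom V} (hp : p ∈ (W k).T) :
    p.1 ∈ atoms Pr D ∧ p.2 ∈ Set.Icc (W k).lo (W k).hi :=
  (hW.states k).1.2.1 p hp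

theorem IsBiRun.agree_step (hW : IsBiRun Pr D w W) (d : Dir) (n : ℕ) {p : TimedAtom V}
    (hp : p.2 ∈ Set.Icc (W (d.step * n)).lo (W (d.step * n)).hi)
    (hp' : p.2 ∈ Set.Icc (W (d.step * (n + 1))).lo (W (d.step * (n + 1))).hi) :
    (p ∈ (W (d.step * (n + 1))).H ↔ p ∈ (W (d.step * n)).H) ∧
      (p ∈ (W (d.step * (n + 1))).T ↔ p ∈ (W (d.step * n)).T) := by
  obtain ⟨-, -, h₁, h₂, -⟩ := hW.trans d n
  constructor
  · by_cases hM : p.1 ∈ atoms Pr D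
    · exact h₁ p.1 hM p.2 ⟨hp', hp⟩
    · exact ⟨fun h => absurd (hW.mem_T (hW.H_subset_T _ h)).1 hM,
        fun h => absurd (hW.mem_T (hW.H_subset_T _ h)).1 hM⟩
  · rw [h₂]
    refine ⟨fun h => ?_, fun h => .inl ⟨h, hp'⟩⟩
    rcases h with h | h
    · exact h.1
    · have h := h.2
      rw [h] at hp
      cases d <;> simp only [Dir.newPoint, Set.mem_Icc] at hp <;> omega

theorem IsBiRun.agree_succ (hW : IsBiRun Pr D w W) (k : ℤ) {p : TimedAtom V}
    (hp : p.2 ∈ Set.Icc ((W 0).lo + (k + 1)) ((W 0).hi + k)) :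
    (p ∈ (W k).H ↔ p ∈ (W (k + 1)).H) ∧ (p ∈ (W k).T ↔ p ∈ (W (k + 1)).T) := by
  rw [Set.mem_Icc] at hp
  have h₁ : p.2 ∈ Set.Icc (W k).lo (W k).hi := by
    rw [hW.lo_eq, hW.hi_eq]; exact ⟨by omega, by omega⟩
  have h₂ : p.2 ∈ Set.Icc (W (k + 1)).lo (W (k + 1)).hi := by
    rw [hW.lo_eq, hW.hi_eq]; exact ⟨by omega, by omega⟩
  rcases le_or_gt 0 k with hk | hk
  · have h := hW.agree_step .right k.toNat (p := p)
    have e : Dir.right.step * (k.toNat : ℤ) = k := by simp [Dir.step, hk]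
    have e' : Dir.right.step * ((k.toNat : ℤ) + 1) = k + 1 := by simp [Dir.step, hk]
    rw [e, e'] at h
    exact ⟨(h h₁ h₂).1.symm, (h h₁ h₂).2.symm⟩
  · have h := hW.agree_step .left (-(k + 1)).toNat (p := p)
    have e : Dir.left.step * ((-(k + 1)).toNat : ℤ) = k + 1 := by simp only [Dir.step]; omega
    have e' : Dir.left.step * (((-(k + 1)).toNat : ℤ) + 1) = k := by simp only [Dir.step]; omega
    rw [e, e'] at h
    exact h h₂ h₁

/-- Sets of facts in consecutive intervals that agree on overlaps glue to a track. -/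
theorem isTrack_iUnion {lo L : ℤ} {G : ℤ → Set (TimedAtom V)}
    (hmem : ∀ k, ∀ p ∈ G k, p.1 ∈ atoms Pr D ∧ p.2 ∈ Set.Icc (lo + k) (lo + k + L))
    (hreal : ∀ k, WTuple.Realised Pr D (lo + k) (lo + k + L) (G k))
    (hstep : ∀ k, ∀ p : TimedAtom V, p.2 ∈ Set.Icc (lo + (k + 1)) (lo + k + L) →
      (p ∈ G k ↔ p ∈ G (k + 1)))
    (hbox : ∀ (d : Dir) M, d.box M ∈ atoms Pr D → ∃ᶠ n : ℕ in atTop,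
      ∃ t ∈ Set.Icc (lo + d.step * n) (lo + d.step * n + L),
        (d.box M, t) ∈ G (d.step * n) ∨ (M, t) ∉ G (d.step * n))
    (hreach : ∀ (d : Dir) M₁ M₂, d.reach M₁ M₂ ∈ atoms Pr D → ∃ᶠ n : ℕ in atTop,
      ∃ t ∈ Set.Icc (lo + d.step * n) (lo + d.step * n + L),
        (d.reach M₁ M₂, t) ∉ G (d.step * n) ∨ (M₂, t) ∈ G (d.step * n)) :
    IsTrack Pr D L (⋃ k, G k) ∧
      ∀ k p, p.2 ∈ Set.Icc (lo + k) (lo + k + L) → (p ∈ G k ↔ p ∈ ⋃ k, G k) := by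
  have hagree : ∀ k m, k ≤ m → ∀ p : TimedAtom V, p.2 ∈ Set.Icc (lo + k) (lo + k + L) →
      p.2 ∈ Set.Icc (lo + m) (lo + m + L) → (p ∈ G k ↔ p ∈ G m) := by
    intro k m hkm p hk
    induction m, hkm using Int.leInduction with
    | base => exact fun _ => Iff.rfl
    | succ m hm ih =>
      intro hp
      rw [Set.mem_Icc] at hk hp
      rw [ih ⟨by omega, by omega⟩]
      exact hstep m p ⟨by omega, by omega⟩
  have hG : ∀ k p, p.2 ∈ Set.Icc (lo + k) (lo + k + L) → (p ∈ G k ↔ p ∈ ⋃ k, G k) := by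
    refine fun k p hp => ⟨fun h => Set.mem_iUnion.2 ⟨k, h⟩, fun h => ?_⟩
    obtain ⟨m, hm⟩ := Set.mem_iUnion.1 h
    rcases le_total k m with hkm | hkm
    · exact (hagree k m hkm p hp (hmem m p hm).2).2 hm
    · exact (hagree m k hkm p (hmem m p hm).2 hp).1 hm
  -- windows with a large index lie far in the given direction
  have far : ∀ (d : Dir) (k : ℤ), ∀ n : ℕ, (|lo| + |L| + |k|).toNat ≤ n →
      ∀ t ∈ Set.Icc (lo + d.step * n) (lo + d.step * n + L), k ≤ d.step * t := by
    intro d k n hn t ht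
    have := neg_abs_le lo
    have := le_abs_self lo
    have := le_abs_self L
    have := le_abs_self k
    rw [Set.mem_Icc] at ht
    cases d <;> simp only [Dir.step] at * <;> omega
  refine ⟨⟨fun p hp => ?_, fun s => ?_, fun d M hM k => ?_, fun d M₁ M₂ hM k => ?_⟩, hG⟩
  · obtain ⟨k, hk⟩ := Set.mem_iUnion.1 hp
    exact (hmem k p hk).1
  · obtain ⟨I, hI⟩ := hreal (s - lo)
    rw [add_sub_cancel] at hI
    refine ⟨I, fun M hM t ht => ?_⟩
    rw [← hI M hM t ht]
    exact (hG (s - lo) (M, t) (by rw [add_sub_cancel]; exact ht)).symm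
  · obtain ⟨n, hn, t, ht, h⟩ := (hbox d M hM).forall_exists_of_atTop (|lo| + |L| + |k|).toNat
    refine ⟨t, far d k n hn t ht, ?_⟩
    rwa [← hG _ _ ht, ← hG _ _ ht]
  · obtain ⟨n, hn, t, ht, h⟩ :=
      (hreach d M₁ M₂ hM).forall_exists_of_atTop (|lo| + |L| + |k|).toNat
    refine ⟨t, far d k n hn t ht, ?_⟩
    rwa [← hG _ _ ht, ← hG _ _ ht]

/-- A two-sided run from a window that entails the data describes an HT-model. -/
theorem IsBiRun.exists_isHTModel (hnorm : Pr.Normalised) (hfresh : FreshSafe Pr D)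
    (hW : IsBiRun Pr D w W) (hlen : tProg Pr ≤ (W 0).hi - (W 0).lo)
    (hD : FactsEntail (W 0).H D) :
    ∃ H T : Interp V, Within Pr D T ∧ IsHTModel Pr D H T ∧
      ∀ k, (W k).H = facts Pr D H (W k).lo (W k).hi ∧
        (W k).T = facts Pr D T (W k).lo (W k).hi := by
  set lo := (W 0).lo with hlo
  set L := (W 0).hi - (W 0).lo with hL
  have hi_eq : ∀ k, (W k).hi = lo + k + L := fun k => by rw [hW.hi_eq]; omega
  have hHtrack := isTrack_iUnion (Pr := Pr) (D := D) (lo := lo) (L := L) (G := fun k => (W k).H)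
    (fun k p hp => by
      have h := hW.mem_T (hW.H_subset_T k hp)
      rwa [hW.lo_eq, hi_eq] at h)
    (fun k => by
      have h := (hW.states k).1.2.2.2.1
      rwa [hW.lo_eq, hi_eq] at h)
    (fun k p hp => (hW.agree_succ k (by rw [Set.mem_Icc] at hp ⊢; omega)).1)
    (fun d M hM => (hW.acc d _ (.inl ⟨M, hM, .inl rfl⟩)).mono fun n hn => by
      have h := hn.2
      rwa [hW.lo_eq, hi_eq] at h)
    (fun d M₁ M₂ hM => (hW.acc d _ (.inr ⟨M₁, M₂, hM, .inl rfl⟩)).mono fun n hn => by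
      have h := hn.2
      rwa [hW.lo_eq, hi_eq] at h)
  have hTtrack := isTrack_iUnion (Pr := Pr) (D := D) (lo := lo) (L := L) (G := fun k => (W k).T)
    (fun k p hp => by
      have h := hW.mem_T hp
      rwa [hW.lo_eq, hi_eq] at h)
    (fun k => by
      have h := (hW.states k).1.2.2.2.2
      rwa [hW.lo_eq, hi_eq] at h)
    (fun k p hp => (hW.agree_succ k (by rw [Set.mem_Icc] at hp ⊢; omega)).2)
    (fun d M hM => (hW.acc d _ (.inl ⟨M, hM, .inr rfl⟩)).mono fun n hn => by
      have h := hn.2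
      rwa [hW.lo_eq, hi_eq] at h)
    (fun d M₁ M₂ hM => (hW.acc d _ (.inr ⟨M₁, M₂, hM, .inr rfl⟩)).mono fun n hn => by
      have h := hn.2
      rwa [hW.lo_eq, hi_eq] at h)
  obtain ⟨hH, hHG⟩ := hHtrack
  obtain ⟨hT, hTG⟩ := hTtrack
  have hHfacts : ∀ k, (W k).H =
      facts Pr D (interpOf (⋃ k, (W k).H)) (W k).lo (W k).hi := by
    intro k
    ext ⟨M, t⟩
    constructor
    · intro hp
      have h := hW.mem_T (hW.H_subset_T k hp)
      exact ⟨h.1, h.2, (hH.sat_iff hnorm hlen h.1 t).2 (Set.mem_iUnion.2 ⟨k, hp⟩)⟩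
    · rintro ⟨hM, ht, hs⟩
      refine (hHG k (M, t) ?_).2 ((hH.sat_iff hnorm hlen hM t).1 hs)
      rwa [← hi_eq, ← hW.lo_eq]
  have hTfacts : ∀ k, (W k).T =
      facts Pr D (interpOf (⋃ k, (W k).T)) (W k).lo (W k).hi := by
    intro k
    ext ⟨M, t⟩
    constructor
    · intro hp
      have h := hW.mem_T hp
      exact ⟨h.1, h.2, (hT.sat_iff hnorm hlen h.1 t).2 (Set.mem_iUnion.2 ⟨k, hp⟩)⟩
    · rintro ⟨hM, ht, hs⟩
      refine (hTG k (M, t) ?_).2 ((hT.sat_iff hnorm hlen hM t).1 hs)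
      rwa [← hi_eq, ← hW.lo_eq]
  refine ⟨_, _, hT.within, (isHTModel_iff hfresh hT.within).2 ⟨?_, ?_, fun t => ?_⟩,
    fun k => ⟨hHfacts k, hTfacts k⟩⟩
  · exact fun t A hA => Set.iUnion_mono (fun k => hW.H_subset_T k) hA
  · refine hD _ fun p hp => ?_
    rw [hHfacts 0] at hp
    exact hp.2.2
  · refine (locallySatisfies_iff (hHfacts (t - lo)) (hTfacts (t - lo))).1
      (hW.states (t - lo)).2.1 t ?_
    have := hW.lo_le_hi 0
    rw [hW.lo_eq, hi_eq]
    exact ⟨by omega, by omega⟩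

end BiRuns

section Completeness

variable {V : Vocabulary.{u, v, w}} {Pr : Program V} {D : Dataset V}

/-- The point by which the window `[lo, hi]` is extended in step `n` in direction `d`. -/
def frontier (lo hi : ℤ) (d : Dir) (n : ℕ) : ℤ :=
  match d with
  | .left => lo - n - 1
  | .right => hi + n + 1

/-- The words that describe `T` outside `[lo, hi]`. -/
def wordsOf (Pr : Program V) (D : Dataset V) (T : Interp V) (lo hi : ℤ) (d : Dir) (n : ℕ) :
    Set (MAtom V V.Const) :=
  slice Pr D T (frontier lo hi d n)

open Classical in
/-- The windows of the pair `(H, T)`. The flag records whether `H` and `T` differ in some window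
between the initial and the current one. -/
noncomputable def windowsOf (Pr : Program V) (D : Dataset V) (H T : Interp V) (lo hi k : ℤ) :
    WTuple V :=
  ⟨lo + k, hi + k, facts Pr D H (lo + k) (hi + k), facts Pr D T (lo + k) (hi + k),
    decide (∃ j ∈ Set.uIcc 0 k,
      facts Pr D H (lo + j) (hi + j) ≠ facts Pr D T (lo + j) (hi + j))⟩

theorem Dir.mem_uIcc_succ (d : Dir) (n : ℕ) (j : ℤ) :
    j ∈ Set.uIcc 0 (d.step * (n + 1)) ↔ j ∈ Set.uIcc 0 (d.step * n) ∨ j = d.step * (n + 1) := by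
  cases d <;> simp only [Dir.step, Set.mem_uIcc] <;> omega

theorem newPoint_eq_frontier {W : WTuple V} {lo hi : ℤ} (d : Dir) (n : ℕ)
    (hlo : W.lo = lo + d.step * n) (hhi : W.hi = hi + d.step * n) :
    d.newPoint W = frontier lo hi d n := by
  cases d <;> simp only [Dir.step, Dir.newPoint, frontier] at * <;> omega

/-- The windows of an HT-model form a two-sided run. An unbounded operator cannot be violated
without a witness, which gives the accepting condition. -/
theorem isBiRun_windowsOf (hfresh : FreshSafe Pr D) {H T : Interp V} (hT : Within Pr D T)
    (h : IsHTModel Pr D H T) {lo hi : ℤ} (hle : lo ≤ hi) :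
    IsBiRun Pr D (wordsOf Pr D T lo hi) (windowsOf Pr D H T lo hi) := by
  rw [isHTModel_iff hfresh hT] at h
  obtain ⟨hHT, -, hsat⟩ := h
  have hstates : ∀ k, windowsOf Pr D H T lo hi k ∈
      autStates Pr D (windowsOf Pr D H T lo hi 0) := by
    refine fun k => ⟨isWindow_of_facts hHT ?_ rfl rfl,
      (locallySatisfies_iff rfl rfl).2 fun t _ => hsat t, ?_⟩
    · exact add_le_add_left hle k
    · simp [windowsOf]
  refine ⟨hstates, fun d n => ⟨?_, ?_, ?_, ?_, ?_⟩, fun d S hS => ?_⟩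
  · simp only [windowsOf]; ring
  · simp only [windowsOf]; ring
  · intro M hM t ht
    exact ⟨fun h => ⟨hM, ht.2, h.2.2⟩, fun h => ⟨hM, ht.1, h.2.2⟩⟩
  · have hs := facts_step (Pr := Pr) (D := D) T d
      (W := windowsOf Pr D H T lo hi (d.step * n)) (add_le_add_left hle _) rfl
    rw [newPoint_eq_frontier d n (lo := lo) (hi := hi) rfl rfl] at hs ⊢
    have e : ∀ a : ℤ, a + d.step * (n + 1) = a + d.step * n + d.step := fun a => by ring
    simp only [windowsOf, e] at hs ⊢
    exact hs
  · simp only [windowsOf, decide_eq_true_eq, Dir.mem_uIcc_succ]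
    constructor
    · rintro ⟨j, hj | rfl, hne⟩
      · exact .inl ⟨j, hj, hne⟩
      · exact .inr hne
    · rintro (⟨j, hj, hne⟩ | hne)
      · exact ⟨j, .inl hj, hne⟩
      · exact ⟨_, .inr rfl, hne⟩
  · -- A box that is false, or a `since` or `untl` that is true, at the window `N` has a witness
    -- there or further on, and the window that starts at the witness is the one required.
    have box : ∀ (I : Interp V) M, d.box M ∈ atoms Pr D → ∀ N : ℕ, ∃ n ≥ N,
        ∃ t ∈ Set.Icc (lo + d.step * n) (hi + d.step * n),
          (d.box M, t) ∈ facts Pr D I (lo + d.step * n) (hi + d.step * n) ∨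
            (M, t) ∉ facts Pr D I (lo + d.step * n) (hi + d.step * n) := by
      intro I M hM N
      by_cases hb : Sat I (lo + d.step * N) (d.box M)
      · have ht : lo + d.step * N ∈ Set.Icc (lo + d.step * N) (hi + d.step * N) :=
          ⟨le_rfl, by omega⟩
        exact ⟨N, le_rfl, _, ht, .inl ⟨hM, ht, hb⟩⟩
      · cases d <;> simp only [Dir.box, Dir.step, Sat, not_forall, mem_unb] at hb ⊢
        · obtain ⟨t, ht, hn⟩ := hb
          exact ⟨(lo - t).toNat, by omega, t, ⟨by omega, by omega⟩, .inr fun h => hn h.2.2⟩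
        · obtain ⟨t, ht, hn⟩ := hb
          exact ⟨(t - lo).toNat, by omega, t, ⟨by omega, by omega⟩, .inr fun h => hn h.2.2⟩
    have reach : ∀ (I : Interp V) M₁ M₂, d.reach M₁ M₂ ∈ atoms Pr D → ∀ N : ℕ, ∃ n ≥ N,
        ∃ t ∈ Set.Icc (lo + d.step * n) (hi + d.step * n),
          (d.reach M₁ M₂, t) ∉ facts Pr D I (lo + d.step * n) (hi + d.step * n) ∨
            (M₂, t) ∈ facts Pr D I (lo + d.step * n) (hi + d.step * n) := by
      intro I M₁ M₂ hM N
      by_cases hb : Sat I (lo + d.step * N) (d.reach M₁ M₂)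
      · have hsub := subatoms_subset_atoms hM
        cases d <;> simp only [Dir.reach, Dir.step, Sat, mem_unb] at hb hM hsub ⊢
        · obtain ⟨t, ht, hn, -⟩ := hb
          have ht' : t ∈ Set.Icc (lo + -1 * ((lo - t).toNat : ℤ))
              (hi + -1 * ((lo - t).toNat : ℤ)) := ⟨by omega, by omega⟩
          exact ⟨(lo - t).toNat, by omega, t, ht',
            .inr ⟨hsub (.inr (.inr M₂.mem_subatoms_self)), ht', hn⟩⟩
        · obtain ⟨t, ht, hn, -⟩ := hb
          have ht' : t ∈ Set.Icc (lo + 1 * ((t - lo).toNat : ℤ)) (hi + 1 * ((t - lo).toNat : ℤ)) :=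
            ⟨by omega, by omega⟩
          exact ⟨(t - lo).toNat, by omega, t, ht',
            .inr ⟨hsub (.inr (.inr M₂.mem_subatoms_self)), ht', hn⟩⟩
      · exact ⟨N, le_rfl, lo + d.step * N, ⟨le_rfl, by omega⟩, .inl fun h => hb h.2.2⟩
    rw [frequently_atTop]
    rintro N
    rcases hS with ⟨M, hM, rfl | rfl⟩ | ⟨M₁, M₂, hM, rfl | rfl⟩
    · obtain ⟨n, hn, h⟩ := box H M hM N
      exact ⟨n, hn, hstates _, h⟩
    · obtain ⟨n, hn, h⟩ := box T M hM N
      exact ⟨n, hn, hstates _, h⟩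
    · obtain ⟨n, hn, h⟩ := reach H M₁ M₂ hM N
      exact ⟨n, hn, hstates _, h⟩
    · obtain ⟨n, hn, h⟩ := reach T M₁ M₂ hM N
      exact ⟨n, hn, hstates _, h⟩

/-- The window of an HT-model over `[tMin, tMax + tProg]` is a possible initial window. -/
theorem isStart_baseWindow (hfresh : FreshSafe Pr D) {H T : Interp V} (hT : Within Pr D T)
    (h : IsHTModel Pr D H T) {b : Bool}
    (hb : b = true ↔ facts Pr D H (tMin D) (tMax D + tProg Pr) ≠
      facts Pr D T (tMin D) (tMax D + tProg Pr)) :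
    (baseWindow Pr D (facts Pr D H (tMin D) (tMax D + tProg Pr))
      (facts Pr D T (tMin D) (tMax D + tProg Pr)) b).IsStart Pr D := by
  rw [isHTModel_iff hfresh hT] at h
  have h₁ := tMin_le_tMax D
  have h₂ := one_le_tProg Pr
  refine ⟨isWindow_of_facts h.1 (show tMin D ≤ tMax D + tProg Pr by omega) rfl rfl, ?_,
    (locallySatisfies_iff rfl rfl).2 fun t _ => h.2.2 t⟩
  cases b
  · exact .inl ⟨of_not_not fun h => Bool.false_ne_true (hb.2 h), rfl⟩
  · exact .inr ⟨hb.1 rfl, rfl⟩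

theorem windowsOf_zero (H T : Interp V) {b : Bool}
    (hb : b = true ↔ facts Pr D H (tMin D) (tMax D + tProg Pr) ≠
      facts Pr D T (tMin D) (tMax D + tProg Pr)) :
    windowsOf Pr D H T (tMin D) (tMax D + tProg Pr) 0 =
      baseWindow Pr D (facts Pr D H (tMin D) (tMax D + tProg Pr))
        (facts Pr D T (tMin D) (tMax D + tProg Pr)) b := by
  have h : (windowsOf Pr D H T (tMin D) (tMax D + tProg Pr) 0).b = b := by
    rw [Bool.eq_iff_iff, hb]
    simp [windowsOf]
  ext1
  · simp [windowsOf, baseWindow]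
  · simp [windowsOf, baseWindow]
  · simp [windowsOf, baseWindow]
  · simp [windowsOf, baseWindow]
  · exact h

variable {w : Dir → ℕ → Set (MAtom V V.Const)} {W : ℤ → WTuple V}

/-- The words of a two-sided run describe the interpretation that its windows are cut out of. -/
theorem IsBiRun.words_eq (hW : IsBiRun Pr D w W) {T : Interp V}
    (hT : ∀ k, (W k).T = facts Pr D T (W k).lo (W k).hi) :
    w = wordsOf Pr D T (W 0).lo (W 0).hi := by
  funext d n
  obtain ⟨hlo, hhi, -, hT', -⟩ := hW.trans d n
  have hs := facts_step (Pr := Pr) (D := D) T d (hW.lo_le_hi _) (hT (d.step * n))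
  rw [hT, hlo, hhi, hs] at hT'
  have hnew := newPoint_eq_frontier d n (hW.lo_eq _) (hW.hi_eq _)
  have hnot : ∀ M, (M, d.newPoint (W (d.step * n))) ∉ (W (d.step * n)).T := by
    intro M hM
    have h := (hW.mem_T hM).2
    cases d <;> simp only [Dir.newPoint, Set.mem_Icc] at h <;> omega
  ext M
  have hiff := Set.ext_iff.1 hT' (M, d.newPoint (W (d.step * n)))
  simp only [Set.mem_union, Set.mem_ofPred_eq, hnot, false_and, false_or, and_true] at hiff
  rw [wordsOf, ← hnew]
  exact hiff.symm

/-- The words and the initial window determine the windows of `T`. -/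
theorem IsBiRun.T_eq {T : Interp V} {lo hi : ℤ} (hW : IsBiRun Pr D (wordsOf Pr D T lo hi) W)
    (hlo : (W 0).lo = lo) (hhi : (W 0).hi = hi) (h₀ : (W 0).T = facts Pr D T lo hi) (k : ℤ) :
    (W k).T = facts Pr D T (W k).lo (W k).hi := by
  obtain ⟨d, n, rfl⟩ := Dir.exists_eq k
  induction n with
  | zero => simpa [hlo, hhi] using h₀
  | succ n ih =>
    obtain ⟨hlo', hhi', -, hT', -⟩ := hW.trans d n
    push_cast
    rw [hT', hlo', hhi', facts_step T d (hW.lo_le_hi _) ih, wordsOf,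
      newPoint_eq_frontier d n ((hW.lo_eq _).trans (by rw [hlo]))
        ((hW.hi_eq _).trans (by rw [hhi]))]

/-- A raised flag is due to a window in which the two sets of facts differ. -/
theorem IsBiRun.exists_ne (hW : IsBiRun Pr D w W) (h₀ : (W 0).Initial) {d : Dir} {n : ℕ}
    (h : (W (d.step * n)).b = true) : ∃ k, (W k).H ≠ (W k).T := by
  induction n with
  | zero =>
    rcases h₀ with ⟨-, h'⟩ | ⟨h', -⟩
    · simp [h'] at h
    · exact ⟨0, h'⟩
  | succ n ih =>
    push_cast at h
    rcases ((hW.trans d n).2.2.2.2).1 h with h | h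
    · exact ih h
    · exact ⟨_, h⟩

theorem IsBiRun.flag_mono (hW : IsBiRun Pr D w W) (d : Dir) {m n : ℕ} (hmn : m ≤ n)
    (h : (W (d.step * m)).b = true) : (W (d.step * n)).b = true := by
  induction n, hmn using Nat.le_induction with
  | base => exact h
  | succ n _ ih =>
    push_cast
    exact ((hW.trans d n).2.2.2.2).2 (.inl ih)

theorem IsBiRun.accepts_autA (hW : IsBiRun Pr D w W) (d : Dir)
    (hw : ∀ n, w d n ⊆ atoms Pr D) : (autA Pr D d (W 0)).Accepts (w d) :=
  ⟨hw, fun n => W (d.step * n), by simp [autA], fun n => hW.states _,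
    fun n => by push_cast; exact hW.trans d n, fun S hS => hW.acc d S hS⟩

theorem IsBiRun.accepts_autB (hW : IsBiRun Pr D w W) (d : Dir)
    (hw : ∀ n, w d n ⊆ atoms Pr D) (h : ∀ k, (W k).H = (W k).T) :
    (autB Pr D d (W 0)).Accepts (w d) :=
  ⟨hw, fun n => W (d.step * n), by simp [autA, autB], fun n => ⟨hW.states _, h _⟩,
    fun n => by push_cast; exact hW.trans d n, fun S hS => hW.acc d S hS⟩

theorem IsBiRun.accepts_autC (hW : IsBiRun Pr D w W) (d : Dir)
    (hw : ∀ n, w d n ⊆ atoms Pr D) {m : ℕ} (h : (W (d.step * m)).b = true) :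
    (autC Pr D d (W 0)).Accepts (w d) := by
  refine ⟨hw, fun n => W (d.step * n), by simp [autA, autC], fun n => hW.states _,
    fun n => by push_cast; exact hW.trans d n, ?_⟩
  rintro S (hS | rfl)
  · exact hW.acc d S hS
  · refine Eventually.frequently (eventually_atTop.2 ⟨m, fun n hn => ?_⟩)
    exact ⟨hW.states _, hW.flag_mono d hn h⟩

theorem accepts_autA_of_autC {d : Dir} {W₀ : WTuple V} {x : ℕ → Set (MAtom V V.Const)}
    (h : (autC Pr D d W₀).Accepts x) : (autA Pr D d W₀).Accepts x := by
  obtain ⟨hx, run, h₀, hs, ht, ha⟩ := h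
  exact ⟨hx, run, h₀, hs, ht, fun S hS => ha S (.inl hS)⟩

end Completeness

/-! ### Stable models and automata -/

section Characterisation

variable {V : Vocabulary.{u, v, w}} {Pr : Program V} {D : Dataset V}

/-- The words of a stable model are accepted together with its base window, and by minimality no
smaller `H` has accepting runs on them whose flag gets raised. -/
theorem IsStableModel.exists_words (hnorm : Pr.Normalised) (hfresh : FreshSafe Pr D)
    (hdata : ∀ f ∈ D, ¬ f.interval.Bounded → Mentioned Pr D f.atom) {T : Interp V}
    (hT : IsStableModel Pr D T) :
    ∃ (T₀ : Set (TimedAtom V)) (w : Dir → ℕ → Set (MAtom V V.Const)),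
      (baseWindow Pr D T₀ T₀ false).IsStart Pr D ∧ FactsEntail T₀ D ∧
        (∀ d n, w d n ⊆ atoms Pr D) ∧
        (∀ d, (autB Pr D d (baseWindow Pr D T₀ T₀ false)).Accepts (w d)) ∧
        ∀ (H₀ : Set (TimedAtom V)) (b₀ : Bool), (baseWindow Pr D H₀ T₀ b₀).IsStart Pr D →
          FactsEntail H₀ D → (∀ d, (autA Pr D d (baseWindow Pr D H₀ T₀ b₀)).Accepts (w d)) →
          ∀ d, ¬ (autC Pr D d (baseWindow Pr D H₀ T₀ b₀)).Accepts (w d) := by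
  have hTw := hT.within hnorm hfresh
  have h₁ := tMin_le_tMax D
  have h₂ := one_le_tProg Pr
  have hle : tMin D ≤ tMax D + tProg Pr := by omega
  have hb : false = true ↔ facts Pr D T (tMin D) (tMax D + tProg Pr) ≠
      facts Pr D T (tMin D) (tMax D + tProg Pr) := by simp
  have hw : ∀ d n, wordsOf Pr D T (tMin D) (tMax D + tProg Pr) d n ⊆ atoms Pr D :=
    fun d n M hM => hM.1
  refine ⟨_, wordsOf Pr D T (tMin D) (tMax D + tProg Pr), isStart_baseWindow hfresh hTw hT.1 hb,
    factsEntail_facts hdata hT.1.2.1 (by omega), hw, fun d => ?_, ?_⟩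
  · rw [← windowsOf_zero T T hb]
    exact (isBiRun_windowsOf hfresh hTw hT.1 hle).accepts_autB d (hw d) fun _ => rfl
  · intro H₀ b₀ hstart hent hA d hC
    set W₀ := baseWindow Pr D H₀ (facts Pr D T (tMin D) (tMax D + tProg Pr)) b₀ with hW₀_def
    -- in direction `d` the run of `𝒞` is used, since it comes with a raised flag
    have hruns : ∀ e, ∃ run : ℕ → WTuple V, run 0 = W₀ ∧ (∀ n, run n ∈ autStates Pr D W₀) ∧
        (∀ n, run (n + 1) ∈
          autTrans Pr D e (run n) (wordsOf Pr D T (tMin D) (tMax D + tProg Pr) e n)) ∧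
        (∀ S ∈ autAcc Pr D e W₀, ∃ᶠ n in atTop, run n ∈ S) ∧
        (e = d → ∃ n, (run n).b = true) := by
      intro e
      by_cases he : e = d
      · subst he
        obtain ⟨-, run, h₀, hs, ht, ha⟩ := hC
        exact ⟨run, h₀, hs, ht, fun S hS => ha S (.inl hS),
          fun _ => (ha _ (.inr rfl)).exists.imp fun _ h => h.2⟩
      · obtain ⟨-, run, h₀, hs, ht, ha⟩ := hA e
        exact ⟨run, h₀, hs, ht, ha, fun h => absurd h he⟩
    choose run h₀ hs ht ha hflag using hruns
    obtain ⟨n, hn⟩ := hflag d rfl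
    obtain ⟨W, hW₀, hW, hrun⟩ := exists_isBiRun h₀ hs ht ha
    obtain ⟨H, T', hT', hmodel, hfacts⟩ := hW.exists_isHTModel hnorm hfresh
      (by rw [hW₀]; change tProg Pr ≤ tMax D + tProg Pr - tMin D; omega) (by rw [hW₀]; exact hent)
    have hTT := hW.T_eq (by rw [hW₀, hW₀_def, baseWindow])
      (by rw [hW₀, hW₀_def, baseWindow]) (by rw [hW₀, hW₀_def, baseWindow])
    have hT'T : T' = T := by
      refine eq_of_facts_eq hT' hTw (hW.lo_le_hi 0) fun k => ?_
      rw [← hW.lo_eq, ← hW.hi_eq, ← (hfacts k).2, hTT]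
    subst hT'T
    have hHT : H = T' := le_antisymm hmodel.1 (hT.2.2 hmodel)
    obtain ⟨k, hk⟩ := hW.exists_ne (by rw [hW₀]; exact hstart.2.1) (d := d) (n := n)
      (by rw [hrun]; exact hn)
    exact hk (by rw [(hfacts k).1, (hfacts k).2, hHT])

/-- Accepted words describe an interpretation, and a smaller HT-model would yield accepting runs
on the same words whose flag is raised from the first difference on. -/
theorem exists_isStableModel (hnorm : Pr.Normalised) (hfresh : FreshSafe Pr D)
    (hdata : ∀ f ∈ D, ¬ f.interval.Bounded → Mentioned Pr D f.atom)
    {T₀ : Set (TimedAtom V)} {w : Dir → ℕ → Set (MAtom V V.Const)} (hent : FactsEntail T₀ D)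
    (hw : ∀ d n, w d n ⊆ atoms Pr D)
    (hB : ∀ d, (autB Pr D d (baseWindow Pr D T₀ T₀ false)).Accepts (w d))
    (hmin : ∀ (H₀ : Set (TimedAtom V)) (b₀ : Bool), (baseWindow Pr D H₀ T₀ b₀).IsStart Pr D →
      FactsEntail H₀ D → (∀ d, (autA Pr D d (baseWindow Pr D H₀ T₀ b₀)).Accepts (w d)) →
      ∀ d, ¬ (autC Pr D d (baseWindow Pr D H₀ T₀ b₀)).Accepts (w d)) :
    ∃ T : Interp V, IsStableModel Pr D T := by
  have h₁ := tMin_le_tMax D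
  have h₂ := one_le_tProg Pr
  choose hx run h₀ hs ht ha using hB
  obtain ⟨W, hW₀, hW, hrun⟩ := exists_isBiRun h₀ (fun d n => (hs d n).1) ht ha
  obtain ⟨H, T, hT, hmodel, hfacts⟩ := hW.exists_isHTModel hnorm hfresh
    (by rw [hW₀]; change tProg Pr ≤ tMax D + tProg Pr - tMin D; omega) (by rw [hW₀]; exact hent)
  have hWeq : ∀ k, (W k).H = (W k).T := by
    intro k
    obtain ⟨d, n, rfl⟩ := Dir.exists_eq k
    rw [hrun]
    exact (hs d n).2
  have hHT : H = T := by
    refine eq_of_facts_eq (hT.mono hmodel.1) hT (hW.lo_le_hi 0) fun k => ?_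
    rw [← hW.lo_eq, ← hW.hi_eq, ← (hfacts k).1, ← (hfacts k).2, hWeq]
  subst hHT
  refine ⟨H, hmodel, hmodel, fun X hX => ?_⟩
  by_contra hne
  have hT₀ : T₀ = facts Pr D H (tMin D) (tMax D + tProg Pr) := by
    have h := (hfacts 0).2
    rw [hW₀] at h
    exact h
  have hww := hW.words_eq fun k => (hfacts k).2
  rw [hW₀] at hww
  subst hT₀
  classical
  have hb : decide (facts Pr D X (tMin D) (tMax D + tProg Pr) ≠
      facts Pr D H (tMin D) (tMax D + tProg Pr)) = true ↔
      facts Pr D X (tMin D) (tMax D + tProg Pr) ≠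
        facts Pr D H (tMin D) (tMax D + tProg Pr) := decide_eq_true_iff
  have hle : tMin D ≤ tMax D + tProg Pr := by omega
  have hX' := isBiRun_windowsOf hfresh hT hX hle
  obtain ⟨d, n, hn⟩ : ∃ (d : Dir) (n : ℕ),
      (windowsOf Pr D X H (tMin D) (tMax D + tProg Pr) (d.step * n)).b = true := by
    by_contra hno
    push Not at hno
    refine hne (eq_of_facts_eq (hT.mono hX.1) hT hle fun k => ?_).ge
    obtain ⟨d, n, rfl⟩ := Dir.exists_eq k
    by_contra hk
    exact hno d n (decide_eq_true ⟨_, Set.right_mem_uIcc, hk⟩)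
  have hww' : w = wordsOf Pr D H (tMin D) (tMax D + tProg Pr) := hww
  subst hww'
  refine hmin _ _ (isStart_baseWindow hfresh hT hX hb)
    (factsEntail_facts hdata hX.2.1 (by omega)) (fun e => ?_) d ?_
  · rw [← windowsOf_zero X H hb]
    exact hX'.accepts_autA e (hw e)
  · rw [← windowsOf_zero X H hb]
    exact hX'.accepts_autC d (hw d) hn

end Characterisation

end DatalogMTL
open DatalogMTL in
theorem mainTheorem6 {V : Vocabulary.{u, v, w}} (Pr : Program V) (D : Dataset V)
    (hnorm : Pr.Normalised)
    (hdata : ∀ f ∈ D, ¬ f.interval.Bounded → Mentioned Pr D f.atom)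
    (hfresh : (∃ c : V.Const, c ∉ constants Pr D) →
      ∀ r ∈ Pr.rules, ∀ x : V.Var, Sum.inr x ∈ r.terms → ¬ r.Guarded x →
        (constants Pr D).Nonempty ∧
        ¬ ((∃ M, r.Has M ∧ Sum.inr x ∈ M.leftTerms) ∧ (∃ M ∈ r.neg, Sum.inr x ∈ M.terms))) :
    (∃ T : Interp V, IsStableModel Pr D T) ↔
      ∃ T₀ : Set (TimedAtom V),
        (baseWindow Pr D T₀ T₀ false).IsStart Pr D ∧ FactsEntail T₀ D ∧
        ∃ wl wr : ℕ → Set (MAtom V V.Const),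
          (∀ n, wl n ⊆ atoms Pr D) ∧ (∀ n, wr n ⊆ atoms Pr D) ∧
          ((autB Pr D .left (baseWindow Pr D T₀ T₀ false)).Accepts wl ∧
            (autB Pr D .right (baseWindow Pr D T₀ T₀ false)).Accepts wr) ∧
          ¬ ∃ (H₀ : Set (TimedAtom V)) (b₀ : Bool),
            (baseWindow Pr D H₀ T₀ b₀).IsStart Pr D ∧ FactsEntail H₀ D ∧
            (((autC Pr D .left (baseWindow Pr D H₀ T₀ b₀)).Accepts wl ∧
                (autA Pr D .right (baseWindow Pr D H₀ T₀ b₀)).Accepts wr) ∨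
              ((autA Pr D .left (baseWindow Pr D H₀ T₀ b₀)).Accepts wl ∧
                (autC Pr D .right (baseWindow Pr D H₀ T₀ b₀)).Accepts wr)) := by
  constructor
  · rintro ⟨T, hT⟩
    obtain ⟨T₀, w, hstart, hent, hw, hB, hmin⟩ := hT.exists_words hnorm hfresh hdata
    refine ⟨T₀, hstart, hent, w .left, w .right, hw _, hw _, ⟨hB _, hB _⟩, ?_⟩
    rintro ⟨H₀, b₀, hs, he, ⟨hC, hA⟩ | ⟨hA, hC⟩⟩
    · refine hmin H₀ b₀ hs he (fun d => ?_) _ hC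
      cases d
      · exact accepts_autA_of_autC hC
      · exact hA
    · refine hmin H₀ b₀ hs he (fun d => ?_) _ hC
      cases d
      · exact hA
      · exact accepts_autA_of_autC hC
  · rintro ⟨T₀, -, hent, wl, wr, hwl, hwr, ⟨hBl, hBr⟩, hmin⟩
    refine exists_isStableModel hnorm hfresh hdata (w := fun d => match d with
      | .left => wl
      | .right => wr) hent ?_ ?_ ?_
    · rintro (_ | _)
      · exact hwl
      · exact hwr
    · rintro (_ | _)
      · exact hBl
      · exact hBr
    · rintro H₀ b₀ hs he hA (_ | _) hC
      · exact hmin ⟨H₀, b₀, hs, he, .inl ⟨hC, hA .right⟩⟩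
      · exact hmin ⟨H₀, b₀, hs, he, .inr ⟨hA .left, hC⟩⟩
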